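/- **Proposition 3.3.** Let $M$ be a Riemann surface with a conformal metric $g$, Gaussian curvature $K_g$, and a spin structure with spinor bundle $\Sigma M=\Sigma^+M\oplus\Sigma^-M$. Denote by $\langle\cdot,\cdot\rangle$ the Hermitian product on $\Sigma M$, linear in the first and conjugate-linear in the second argument, by $X\cdot\psi$ the Clifford multiplication ($X\cdot Y\cdot\psi+Y\cdot X\cdot\psi=-2g(X,Y)\psi$), by $\nabla$ the Levi-Civita and the spin connection, and by $D\psi=\sum_\alpha e_\alpha\cdot\nabla_{e_\alpha}\psi$ the Dirac operator. Let $u:M\to\mathbb R$ be a smooth function and $\psi$ a smooth spinor field with $$-\Delta_g u=2e^{2u}-e^u\langle\psi,\psi\rangle-K_g,\qquad D\psi=-e^u\psi\qquad\text{in }M .$$ For a local isothermal parameter (holomorphic chart) $z=x+iy$ with $g=\rho|dz|^2$ put $$T(z)=(\partial_zu)^2-\partial_z^2u+\tfrac14\langle\psi,dz\cdot\partial_{\bar z}\psi\rangle+\tfrac14\langle d\bar z\cdot\partial_z\psi,\psi\rangle ,$$ where $\partial_z^2u=(\nabla^2u)(\partial_z,\partial_z)=\partial_z(\partial_zu)-(\partial_z\log\rho)\,\partial_zu$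 is the second covariant derivative, $\partial_z\psi=\frac12(\nabla_{\partial_x}\psi-i\nabla_{\partial_y}\psi)$, $\partial_{\bar z}\psi=\frac12(\nabla_{\partial_x}\psi+i\nabla_{\partial_y}\psi)$, and $dz=dx+i\,dy$, $d\bar z=dx-i\,dy$ act by Clifford multiplication with the vectors $\partial_x+i\partial_y$, $\partial_x-i\partial_y$ respectively. Then $T$ is a well-defined smooth function on the domain of $z$ (it does not depend on the local trivialization of $\Sigma M$), and $T(z)\,dz^2$ is a quadratic differential: $T_z=T_{z'}\,(dz'/dz)^2$ for any two such parameters $z,z'$ on the common part of their domains. In every such parameter $$\partial_{\bar z}T=-\frac{\rho}{4}\,\partial_zK_g .$$ In particular, if $K_g$ is constant, then the quadratic differential $T(z)\,dz^2$ is holomorphic. -/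

import Mathlib

open scoped Manifold ContDiff

noncomputable section

namespace SuperLiouville

/-! ### Calculus in a coordinate domain of `ℂ = ℝ²`, with coordinates `x⁰ = x`, `x¹ = y` -/

/-- The coordinate vectors `∂₀ = ∂/∂x` and `∂₁ = ∂/∂y`, as elements of `ℂ = ℝ²`. -/
def coordVec : Fin 2 → ℂ := ![1, Complex.I]

/-- The partial derivative `∂ᵢ f`. -/
def pd {E : Type*} [NormedAddCommGroup E] [NormedSpace ℝ E] (i : Fin 2) (f : ℂ → E) (w : ℂ) : E :=
  fderiv ℝ f w (coordVec i)

/-- `∂_z = ½ (∂ₓ - i ∂_y)`. -/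
def dz (f : ℂ → ℂ) (w : ℂ) : ℂ := (1 / 2) * (pd 0 f w - Complex.I * pd 1 f w)

/-- `∂_{z̄} = ½ (∂ₓ + i ∂_y)`. -/
def dzbar (f : ℂ → ℂ) (w : ℂ) : ℂ := (1 / 2) * (pd 0 f w + Complex.I * pd 1 f w)

/-! ### Riemannian geometry of a metric `G = (G_{ij})` in a coordinate domain -/

/-- Christoffel symbols `Γᵏᵢⱼ = ½ gᵏˡ (∂ᵢ g_{jl} + ∂ⱼ g_{il} - ∂ₗ g_{ij})`. -/
def christoffel (G : ℂ → Matrix (Fin 2) (Fin 2) ℝ) (k i j : Fin 2) (w : ℂ) : ℝ :=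
  (1 / 2) * ∑ l, (G w)⁻¹ k l *
    (pd i (fun x => G x j l) w + pd j (fun x => G x i l) w - pd l (fun x => G x i j) w)

/-- The component `(∇_{∂ᵢ} X)ᵏ = ∂ᵢ Xᵏ + Γᵏᵢⱼ Xʲ` of the Levi-Civita derivative of `X = Xᵏ ∂ₖ`. -/
def covDeriv (G : ℂ → Matrix (Fin 2) (Fin 2) ℝ) (i : Fin 2) (X : Fin 2 → ℂ → ℝ)
    (k : Fin 2) (w : ℂ) : ℝ :=
  pd i (X k) w + ∑ j, christoffel G k i j w * X j w

/-- The Hessian `(∇²u)(∂ᵢ, ∂ⱼ) = ∂ᵢ∂ⱼ u - Γᵏᵢⱼ ∂ₖ u`. -/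
def hessian (G : ℂ → Matrix (Fin 2) (Fin 2) ℝ) (u : ℂ → ℝ) (i j : Fin 2) (w : ℂ) : ℝ :=
  pd i (pd j u) w - ∑ k, christoffel G k i j w * pd k u w

/-- The Laplace-Beltrami operator `Δu = gⁱʲ (∇²u)(∂ᵢ, ∂ⱼ)`. -/
def laplacian (G : ℂ → Matrix (Fin 2) (Fin 2) ℝ) (u : ℂ → ℝ) (w : ℂ) : ℝ :=
  ∑ i, ∑ j, (G w)⁻¹ i j * hessian G u i j w

/-- The component along `∂ₗ` of the curvature
`R(∂ᵢ, ∂ⱼ) ∂ₖ = ∇_{∂ᵢ} ∇_{∂ⱼ} ∂ₖ - ∇_{∂ⱼ} ∇_{∂ᵢ} ∂ₖ`. -/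
def riemann (G : ℂ → Matrix (Fin 2) (Fin 2) ℝ) (l k i j : Fin 2) (w : ℂ) : ℝ :=
  pd i (christoffel G l j k) w - pd j (christoffel G l i k) w
    + ∑ m, (christoffel G l i m w * christoffel G m j k w
      - christoffel G l j m w * christoffel G m i k w)

/-- The Gaussian curvature `g(R(∂₀, ∂₁) ∂₁, ∂₀) / det g`. -/
def curvature (G : ℂ → Matrix (Fin 2) (Fin 2) ℝ) (w : ℂ) : ℝ :=
  (∑ l, G w l 0 * riemann G l 1 0 1 w) / (G w).det

/-- The matrix of the metric `ρ |dz|²`. -/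
def confMatrix (ρ : ℂ → ℝ) (w : ℂ) : Matrix (Fin 2) (Fin 2) ℝ := ρ w • 1

/-! ### Spinors in an isothermal coordinate domain with metric `ρ |dz|²`

Spinors are written as `ℂ²`-valued functions in the trivialization given by a spin lift of the
oriented orthonormal frame `e₀ = ρ^{-1/2} ∂ₓ`, `e₁ = ρ^{-1/2} ∂_y`. -/

/-- The Hermitian product of spinors, linear in the first and conjugate-linear in the second
argument. -/
def herm (a b : Fin 2 → ℂ) : ℂ := ∑ k, a k * (starRingEnd ℂ) (b k)

/-- The matrices of Clifford multiplication by `e₀` and `e₁`. -/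
def gam : Fin 2 → Matrix (Fin 2) (Fin 2) ℂ :=
  ![!![0, 1; -1, 0], !![0, Complex.I; Complex.I, 0]]

/-- Components `e_αᵏ` of the orthonormal frame `e_α = ρ^{-1/2} ∂_α`. -/
def frame (ρ : ℂ → ℝ) (α k : Fin 2) (w : ℂ) : ℝ := if k = α then (Real.sqrt (ρ w))⁻¹ else 0

/-- Clifford multiplication by the tangent vector `v = v⁰ ∂₀ + v¹ ∂₁ = ρ^{1/2} (v⁰ e₀ + v¹ e₁)`. -/
def cliff (ρ : ℂ → ℝ) (w v : ℂ) : Matrix (Fin 2) (Fin 2) ℂ :=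
  ((Real.sqrt (ρ w) * v.re : ℝ) : ℂ) • gam 0 + ((Real.sqrt (ρ w) * v.im : ℝ) : ℂ) • gam 1

/-- The connection form `ω(∂ⱼ) = g(∇_{∂ⱼ} e₀, e₁)` of the orthonormal frame. -/
def connForm (ρ : ℂ → ℝ) (j : Fin 2) (w : ℂ) : ℝ :=
  ∑ k, ∑ l, confMatrix ρ w k l * covDeriv (confMatrix ρ) j (frame ρ 0) k w * frame ρ 1 l w

/-- The spin connection `∇_v φ = dφ(v) + ½ g(∇_v e₀, e₁) e₀ · e₁ · φ`. -/
def spinDeriv (ρ : ℂ → ℝ) (φ : ℂ → Fin 2 → ℂ) (w v : ℂ) : Fin 2 → ℂ :=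
  fderiv ℝ φ w v +
    ((1 / 2 * (v.re * connForm ρ 0 w + v.im * connForm ρ 1 w) : ℝ) : ℂ) •
      (gam 0 * gam 1).mulVec (φ w)

/-- The Dirac operator `D φ = ∑_α e_α · ∇_{e_α} φ`. -/
def dirac (ρ : ℂ → ℝ) (φ : ℂ → Fin 2 → ℂ) (w : ℂ) : Fin 2 → ℂ :=
  ∑ α, (gam α).mulVec
    (spinDeriv ρ φ w (∑ k, ((frame ρ α k w : ℝ) : ℂ) * coordVec k))

/-! ### Riemann surfaces with a conformal metric, spin structures and spinors -/

section Surface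

variable (M : Type*) [TopologicalSpace M] [ChartedSpace ℂ M]

/-- The holomorphic charts `z` of the Riemann surface `M`. For a conformal metric these are exactly
the (orientation preserving) local isothermal parameters. -/
def holCharts : Set (OpenPartialHomeomorph M ℂ) := IsManifold.maximalAtlas 𝓘(ℂ) ω M

/-- A conformal Riemannian metric: in each holomorphic chart `z` it is `ρ |dz|²` with `ρ` smooth
and positive, and `ρ_z |dz|² = ρ_{z'} |dz'|²` on overlaps. -/
structure ConformalMetric where
  density : OpenPartialHomeomorph M ℂ → ℂ → ℝ
  smooth : ∀ c ∈ holCharts M, ContDiffOn ℝ ∞ (density c) c.target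
  pos : ∀ c ∈ holCharts M, ∀ w ∈ c.target, 0 < density c w
  compat : ∀ c ∈ holCharts M, ∀ c' ∈ holCharts M, ∀ p ∈ c.source ∩ c'.source,
    density c (c p) = density c' (c' p) * ‖deriv (c' ∘ c.symm) (c p)‖ ^ 2

/-- A spin structure, given by a lifted cocycle of the oriented orthonormal frame bundle. `M` is
covered by holomorphic charts `zᵢ`; the oriented orthonormal frames `ρᵢ^{-1/2} (∂_{xᵢ}, ∂_{yᵢ})`
and `ρⱼ^{-1/2} (∂_{xⱼ}, ∂_{yⱼ})` differ by the rotation `a / |a|` with `a = dzⱼ / dzᵢ`, and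
`lift i j` is a lift of this `SO(2)`-valued cocycle to a cocycle with values in `Spin(2) = U(1)`
under the double covering `s ↦ s²` of `SO(2) = U(1)`. -/
structure SpinStructure where
  ι : Type*
  chart : ι → OpenPartialHomeomorph M ℂ
  chart_mem : ∀ i, chart i ∈ holCharts M
  indexAt : M → ι
  mem_source : ∀ p, p ∈ (chart (indexAt p)).source
  lift : ι → ι → M → Circle
  lift_continuous : ∀ i j, ContinuousOn (lift i j) ((chart i).source ∩ (chart j).source)
  lift_sq : ∀ i j, ∀ p ∈ (chart i).source ∩ (chart j).source,
    (lift i j p : ℂ) ^ 2 =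
      deriv (chart j ∘ (chart i).symm) (chart i p) /
        (‖deriv (chart j ∘ (chart i).symm) (chart i p)‖ : ℂ)
  lift_cocycle : ∀ i j k, ∀ p ∈ (chart i).source ∩ (chart j).source ∩ (chart k).source,
    lift i j p * lift j k p = lift i k p

variable {M}

/-- A smooth section of the spinor bundle `ΣM = Σ⁺M ⊕ Σ⁻M`, given by its components in the
trivializations of the spin structure. `Σ⁺M` is associated to the standard representation of
`Spin(2) = U(1)` and `Σ⁻M` is its complex conjugate. -/
structure SmoothSpinor (S : SpinStructure M) where
  comp : S.ι → M → Fin 2 → ℂ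
  compat : ∀ i j, ∀ p ∈ (S.chart i).source ∩ (S.chart j).source,
    comp j p = ![(S.lift i j p : ℂ) * comp i p 0,
      (starRingEnd ℂ) (S.lift i j p : ℂ) * comp i p 1]
  smooth : ∀ i, ContDiffOn ℝ ∞ (comp i ∘ (S.chart i).symm) (S.chart i).target

/-- The components of `ψ` in the `i`-th trivialization, as a function of the coordinate `zᵢ`. -/
def SmoothSpinor.loc {S : SpinStructure M} (ψ : SmoothSpinor S) (i : S.ι) : ℂ → Fin 2 → ℂ :=
  ψ.comp i ∘ (S.chart i).symm

/-- `|ψ|²`, a function on `M`. -/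
def SmoothSpinor.normSq {S : SpinStructure M} (ψ : SmoothSpinor S) (p : M) : ℝ :=
  (herm (ψ.comp (S.indexAt p) p) (ψ.comp (S.indexAt p) p)).re

/-- The matrix of the metric in the chart `c`. -/
def ConformalMetric.mat (g : ConformalMetric M) (c : OpenPartialHomeomorph M ℂ) :
    ℂ → Matrix (Fin 2) (Fin 2) ℝ := confMatrix (g.density c)

/-- The Gaussian curvature `K_g` as a function of the coordinate of the chart `c`. -/
def ConformalMetric.gauss (g : ConformalMetric M) (c : OpenPartialHomeomorph M ℂ) : ℂ → ℝ :=
  curvature (g.mat c)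

/-- `(u, ψ)` is a smooth solution of the super-Liouville equations
`-Δu = 2 e^{2u} - e^u |ψ|² - K_g`, `D ψ = -e^u ψ`. -/
structure IsSmoothSolution (g : ConformalMetric M) (S : SpinStructure M)
    (u : M → ℝ) (ψ : SmoothSpinor S) : Prop where
  smooth : ∀ c ∈ holCharts M, ContDiffOn ℝ ∞ (u ∘ c.symm) c.target
  liouville : ∀ c ∈ holCharts M, ∀ p ∈ c.source,
    -laplacian (g.mat c) (u ∘ c.symm) (c p) =
      2 * Real.exp (2 * u p) - Real.exp (u p) * ψ.normSq p - g.gauss c (c p)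
  dirac : ∀ i, ∀ p ∈ (S.chart i).source,
    dirac (g.density (S.chart i)) (ψ.loc i) (S.chart i p) =
      -((Real.exp (u p) : ℝ) : ℂ) • ψ.comp i p

/-- `∂_z u` in the chart `z = c`. -/
def dzFun (u : M → ℝ) (c : OpenPartialHomeomorph M ℂ) (w : ℂ) : ℂ :=
  (1 / 2) * (((pd 0 (u ∘ c.symm) w : ℝ) : ℂ) - Complex.I * ((pd 1 (u ∘ c.symm) w : ℝ) : ℂ))

/-- `∂_z² u`, the second covariant derivative `(∇²u)(∂_z, ∂_z)`, `∂_z = ½ (∂ₓ - i ∂_y)`, in the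
chart `z = c`. -/
def dzzFun (g : ConformalMetric M) (u : M → ℝ) (c : OpenPartialHomeomorph M ℂ) (w : ℂ) : ℂ :=
  (1 / 4) * (((hessian (g.mat c) (u ∘ c.symm) 0 0 w : ℝ) : ℂ)
    - ((hessian (g.mat c) (u ∘ c.symm) 1 1 w : ℝ) : ℂ)
    - Complex.I * (((hessian (g.mat c) (u ∘ c.symm) 0 1 w : ℝ) : ℂ)
      + ((hessian (g.mat c) (u ∘ c.symm) 1 0 w : ℝ) : ℂ)))

/-- `⟨ψ, dz · ∂_{z̄} ψ⟩ + ⟨dz̄ · ∂_z ψ, ψ⟩` in the chart `z = c` at the point with coordinate `w`,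
computed in the `i`-th trivialization of the spinor bundle. Here `dz = dx + i dy` acts by Clifford
multiplication with `∂ₓ + i ∂_y`, `dz̄` with `∂ₓ - i ∂_y`, and
`∂_z ψ = ½ (∇_{∂ₓ} ψ - i ∇_{∂_y} ψ)`, `∂_{z̄} ψ = ½ (∇_{∂ₓ} ψ + i ∇_{∂_y} ψ)`. The vectors `X`, `Y`
below are `∂ₓ`, `∂_y` of the chart `c`, expressed in the chart of the trivialization. -/
def spinorTerm (g : ConformalMetric M) {S : SpinStructure M} (ψ : SmoothSpinor S)
    (c : OpenPartialHomeomorph M ℂ) (i : S.ι) (w : ℂ) : ℂ :=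
  let ρ := g.density (S.chart i)
  let q : ℂ := S.chart i (c.symm w)
  let φ := ψ.loc i
  let X : ℂ := fderiv ℝ (S.chart i ∘ c.symm) w (coordVec 0)
  let Y : ℂ := fderiv ℝ (S.chart i ∘ c.symm) w (coordVec 1)
  let nz : Fin 2 → ℂ := (1 / 2 : ℂ) • (spinDeriv ρ φ q X - Complex.I • spinDeriv ρ φ q Y)
  let nzbar : Fin 2 → ℂ := (1 / 2 : ℂ) • (spinDeriv ρ φ q X + Complex.I • spinDeriv ρ φ q Y)
  herm (φ q) ((cliff ρ q X + Complex.I • cliff ρ q Y).mulVec nzbar)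
    + herm ((cliff ρ q X - Complex.I • cliff ρ q Y).mulVec nz) (φ q)

/-- The coefficient `T` of `T(z) dz²` in the chart `z = c`, with the spinor terms computed in the
`i`-th trivialization of the spinor bundle. -/
def localT (g : ConformalMetric M) {S : SpinStructure M} (u : M → ℝ) (ψ : SmoothSpinor S)
    (c : OpenPartialHomeomorph M ℂ) (i : S.ι) (w : ℂ) : ℂ :=
  dzFun u c w ^ 2 - dzzFun g u c w + (1 / 4) * spinorTerm g ψ c i w

/-- The coefficient `T` of `T(z) dz²` in the chart `z = c`. -/
def coeffT (g : ConformalMetric M) {S : SpinStructure M} (u : M → ℝ) (ψ : SmoothSpinor S)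
    (c : OpenPartialHomeomorph M ℂ) (w : ℂ) : ℂ :=
  localT g u ψ c (S.indexAt (c.symm w)) w

end Surface

end SuperLiouville

end

namespace SuperLiouville

open Filter Topology

/-! In an isothermal coordinate the statement reduces to Wirtinger calculus. Write A = ∂_z u, L =
∂_z log ρ, K for the curvature and F = 2e^{2u} - e^u|ψ|² - K. The second covariant derivative is ∂_z
A - L A (`hessian_eq_dz_dz`), the Liouville equation is ∂_z̄ A = -ρF/4 (`laplacian_eq_dzbar_dz`),
and the curvature enters as ∂_z̄ L = -ρK/2 (`curvature_eq_dzbar_dzLog`).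

For a spinor with components φ₀, φ₁ the connection terms cancel, and the spinor terms become 2√ρ W
with the Wronskian W = ∂_zφ₁ φ̄₀ - φ₁ ∂_zφ̄₀ (`spinorTerm_coord`). Differentiating the Dirac system
gives ∂_z̄(√ρ W) = ½ρe^u(∂_z|ψ|² - |ψ|²∂_z u) (`dzbar_sqrt_mul_spinWronskian`). This cancels every
|ψ|² term that the Liouville equation produces, so that only -ρ∂_zK/4 survives (`dzbar_quadratic`).

The invariance statements rest on two cancellations. Under a holomorphic change of coordinate, the
second derivative of the transition map appears both in ∂_z A and in L A and drops out
(`quadratic_comp`). Under a change of trivialization, φ₁ and φ̄₀ are multiplied by the same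
unimodular function, whose derivative drops out of the Wronskian
(`sqrt_mul_spinWronskian_transition`). -/

/-! ### Wirtinger calculus -/

lemma pd_congr {E : Type*} [NormedAddCommGroup E] [NormedSpace ℝ E] {f g : ℂ → E} {w : ℂ}
    (h : f =ᶠ[𝓝 w] g) (i : Fin 2) : pd i f w = pd i g w := by
  simp only [pd, h.fderiv_eq]

lemma dz_congr {f g : ℂ → ℂ} {w : ℂ} (h : f =ᶠ[𝓝 w] g) : dz f w = dz g w := by
  simp only [dz, pd_congr h]

lemma dzbar_congr {f g : ℂ → ℂ} {w : ℂ} (h : f =ᶠ[𝓝 w] g) : dzbar f w = dzbar g w := by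
  simp only [dzbar, pd_congr h]

lemma pd_zero {E : Type*} [NormedAddCommGroup E] [NormedSpace ℝ E] (f : ℂ → E) (w : ℂ) :
    pd 0 f w = fderiv ℝ f w 1 := rfl

lemma pd_one {E : Type*} [NormedAddCommGroup E] [NormedSpace ℝ E] (f : ℂ → E) (w : ℂ) :
    pd 1 f w = fderiv ℝ f w Complex.I := rfl

lemma contDiffAt_pd {E : Type*} [NormedAddCommGroup E] [NormedSpace ℝ E] {f : ℂ → E} {w : ℂ}
    (hf : ContDiffAt ℝ ∞ f w) (i : Fin 2) : ContDiffAt ℝ ∞ (pd i f) w :=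
  (hf.fderiv_right (m := ∞) (by simp)).clm_apply contDiffAt_const

lemma contDiffAt_dz {f : ℂ → ℂ} {w : ℂ} (hf : ContDiffAt ℝ ∞ f w) : ContDiffAt ℝ ∞ (dz f) w :=
  contDiffAt_const.mul ((contDiffAt_pd hf 0).sub (contDiffAt_const.mul (contDiffAt_pd hf 1)))

lemma contDiffAt_dzbar {f : ℂ → ℂ} {w : ℂ} (hf : ContDiffAt ℝ ∞ f w) :
    ContDiffAt ℝ ∞ (dzbar f) w :=
  contDiffAt_const.mul ((contDiffAt_pd hf 0).add (contDiffAt_const.mul (contDiffAt_pd hf 1)))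

lemma _root_.ContDiffAt.differentiableAt_of_infty {E F : Type*} [NormedAddCommGroup E]
    [NormedSpace ℝ E] [NormedAddCommGroup F] [NormedSpace ℝ F] {f : E → F} {w : E}
    (hf : ContDiffAt ℝ ∞ f w) : DifferentiableAt ℝ f w :=
  hf.differentiableAt (by simp)

/-- The splitting of a real-linear map into its complex-linear and conjugate-linear parts. It
underlies the chain rules and the spin derivative along an arbitrary vector. -/
lemma fderiv_eq_dz_dzbar (f : ℂ → ℂ) (w v : ℂ) :
    fderiv ℝ f w v = dz f w * v + dzbar f w * (starRingEnd ℂ) v := by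
  have hv : v = v.re • (1 : ℂ) + v.im • Complex.I := by
    simp [Complex.re_add_im]
  have h2 : fderiv ℝ f w v = v.re * fderiv ℝ f w 1 + v.im * fderiv ℝ f w Complex.I := by
    conv_lhs => rw [hv]
    rw [map_add, map_smul, map_smul, Complex.real_smul, Complex.real_smul]
  rw [h2, dz, dzbar, pd_zero, pd_one]
  apply Complex.ext <;> simp <;> ring

lemma pd_comm {E : Type*} [NormedAddCommGroup E] [NormedSpace ℝ E] {f : ℂ → E} {w : ℂ}
    (hf : ContDiffAt ℝ ∞ f w) (i j : Fin 2) : pd i (pd j f) w = pd j (pd i f) w := by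
  have hd : DifferentiableAt ℝ (fderiv ℝ f) w :=
    (hf.fderiv_right (m := ∞) (by simp)).differentiableAt_of_infty
  have key : ∀ i j : Fin 2, pd i (pd j f) w = fderiv ℝ (fderiv ℝ f) w (coordVec i) (coordVec j) := by
    intro i j
    change fderiv ℝ (fun x => fderiv ℝ f x (coordVec j)) w (coordVec i) = _
    rw [fderiv_clm_apply hd (differentiableAt_const _)]
    simp
  rw [key, key]
  exact hf.isSymmSndFDerivAt (by
    rw [minSmoothness_of_isRCLikeNormedField]; exact WithTop.coe_le_coe.2 (le_top : (2 : ℕ∞) ≤ ⊤)) _ _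

section Rules

variable {f g : ℂ → ℂ} {w : ℂ}

lemma dz_add (hf : DifferentiableAt ℝ f w) (hg : DifferentiableAt ℝ g w) :
    dz (fun x => f x + g x) w = dz f w + dz g w := by
  simp only [dz, pd, fderiv_fun_add hf hg, add_apply]; ring

lemma dz_sub (hf : DifferentiableAt ℝ f w) (hg : DifferentiableAt ℝ g w) :
    dz (fun x => f x - g x) w = dz f w - dz g w := by
  simp only [dz, pd, fderiv_fun_sub hf hg, sub_apply]; ring

lemma dz_mul (hf : DifferentiableAt ℝ f w) (hg : DifferentiableAt ℝ g w) :
    dz (fun x => f x * g x) w = dz f w * g w + f w * dz g w := by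
  simp only [dz, pd, fderiv_fun_mul hf hg, add_apply,
    smul_apply, smul_eq_mul]; ring

lemma dz_const_mul (a : ℂ) (hf : DifferentiableAt ℝ f w) :
    dz (fun x => a * f x) w = a * dz f w := by
  rw [dz_mul (differentiableAt_const _) hf]
  simp [dz, pd]

lemma dz_star (hf : DifferentiableAt ℝ f w) :
    dz (fun x => (starRingEnd ℂ) (f x)) w = (starRingEnd ℂ) (dzbar f w) := by
  have h : HasFDerivAt (fun x => (starRingEnd ℂ) (f x))
      ((Complex.conjCLE : ℂ →L[ℝ] ℂ).comp (fderiv ℝ f w)) w :=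
    (Complex.conjCLE : ℂ →L[ℝ] ℂ).hasFDerivAt.comp w hf.hasFDerivAt
  simp [dz, dzbar, pd, h.fderiv, Complex.conj_ofNat]; ring

lemma dzbar_add (hf : DifferentiableAt ℝ f w) (hg : DifferentiableAt ℝ g w) :
    dzbar (fun x => f x + g x) w = dzbar f w + dzbar g w := by
  simp only [dzbar, pd, fderiv_fun_add hf hg, add_apply]; ring

lemma dzbar_sub (hf : DifferentiableAt ℝ f w) (hg : DifferentiableAt ℝ g w) :
    dzbar (fun x => f x - g x) w = dzbar f w - dzbar g w := by
  simp only [dzbar, pd, fderiv_fun_sub hf hg, sub_apply]; ring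

lemma dzbar_mul (hf : DifferentiableAt ℝ f w) (hg : DifferentiableAt ℝ g w) :
    dzbar (fun x => f x * g x) w = dzbar f w * g w + f w * dzbar g w := by
  simp only [dzbar, pd, fderiv_fun_mul hf hg, add_apply,
    smul_apply, smul_eq_mul]; ring

lemma dzbar_const_mul (a : ℂ) (hf : DifferentiableAt ℝ f w) :
    dzbar (fun x => a * f x) w = a * dzbar f w := by
  rw [dzbar_mul (differentiableAt_const _) hf]
  simp [dzbar, pd]

lemma dzbar_star (hf : DifferentiableAt ℝ f w) :
    dzbar (fun x => (starRingEnd ℂ) (f x)) w = (starRingEnd ℂ) (dz f w) := by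
  have h : HasFDerivAt (fun x => (starRingEnd ℂ) (f x))
      ((Complex.conjCLE : ℂ →L[ℝ] ℂ).comp (fderiv ℝ f w)) w :=
    (Complex.conjCLE : ℂ →L[ℝ] ℂ).hasFDerivAt.comp w hf.hasFDerivAt
  simp [dz, dzbar, pd, h.fderiv, Complex.conj_ofNat]

/-- Chain rule with a holomorphic outer function. -/
lemma dz_hasDerivAt_comp {F : ℂ → ℂ} {F' : ℂ} (hF : HasDerivAt F F' (f w))
    (hf : DifferentiableAt ℝ f w) : dz (fun x => F (f x)) w = F' * dz f w := by
  have h := HasFDerivAt.comp w hF.complexToReal_fderiv hf.hasFDerivAt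
  simp only [dz, pd]
  rw [show (fun x => F (f x)) = F ∘ f from rfl, h.fderiv]
  simp; ring

/-- Chain rule with a holomorphic inner function. -/
lemma dz_comp_hasDerivAt {F : ℂ → ℂ} {f' : ℂ} (hf : HasDerivAt f f' w)
    (hF : DifferentiableAt ℝ F (f w)) : dz (fun x => F (f x)) w = dz F (f w) * f' := by
  have h := HasFDerivAt.comp w hF.hasFDerivAt hf.complexToReal_fderiv
  rw [dz, pd, pd, show (fun x => F (f x)) = F ∘ f from rfl, h.fderiv]
  simp only [ContinuousLinearMap.comp_apply, fderiv_eq_dz_dzbar F]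
  simp [coordVec]
  linear_combination -(1 / 2) * (dz F (f w) * f' - dzbar F (f w) * (starRingEnd ℂ) f') * Complex.I_sq

lemma dzbar_comp_hasDerivAt {F : ℂ → ℂ} {f' : ℂ} (hf : HasDerivAt f f' w)
    (hF : DifferentiableAt ℝ F (f w)) :
    dzbar (fun x => F (f x)) w = dzbar F (f w) * (starRingEnd ℂ) f' := by
  have h := HasFDerivAt.comp w hF.hasFDerivAt hf.complexToReal_fderiv
  rw [dzbar, pd, pd, show (fun x => F (f x)) = F ∘ f from rfl, h.fderiv]
  simp only [ContinuousLinearMap.comp_apply, fderiv_eq_dz_dzbar F]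
  simp [coordVec]
  linear_combination (1 / 2) * (dz F (f w) * f' - dzbar F (f w) * (starRingEnd ℂ) f') * Complex.I_sq

lemma dz_of_hasDerivAt {f' : ℂ} (hf : HasDerivAt f f' w) : dz f w = f' := by
  simp only [dz, pd, hf.complexToReal_fderiv.fderiv]
  simp [coordVec]
  linear_combination -(1 / 2) * f' * Complex.I_sq

lemma dzbar_of_hasDerivAt {f' : ℂ} (hf : HasDerivAt f f' w) : dzbar f w = 0 := by
  simp only [dzbar, pd, hf.complexToReal_fderiv.fderiv]
  simp [coordVec]
  linear_combination f' * Complex.I_sq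

lemma pd_add {E : Type*} [NormedAddCommGroup E] [NormedSpace ℝ E] {f g : ℂ → E} {w : ℂ}
    (hf : DifferentiableAt ℝ f w) (hg : DifferentiableAt ℝ g w) (i : Fin 2) :
    pd i (fun x => f x + g x) w = pd i f w + pd i g w := by
  simp [pd, fderiv_fun_add hf hg]

lemma pd_sub {E : Type*} [NormedAddCommGroup E] [NormedSpace ℝ E] {f g : ℂ → E} {w : ℂ}
    (hf : DifferentiableAt ℝ f w) (hg : DifferentiableAt ℝ g w) (i : Fin 2) :
    pd i (fun x => f x - g x) w = pd i f w - pd i g w := by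
  simp [pd, fderiv_fun_sub hf hg]

lemma pd_const_mul (a : ℂ) (hf : DifferentiableAt ℝ f w) (i : Fin 2) :
    pd i (fun x => a * f x) w = a * pd i f w := by
  simp [pd, fderiv_const_mul hf]

/-- Symmetry of second derivatives. It turns ∂_z̄ of an uncontrolled ∂_z-derivative into ∂_z of a
∂_z̄-derivative that the Liouville or Dirac equation prescribes. -/
lemma dz_dzbar_comm (hf : ContDiffAt ℝ ∞ f w) : dz (dzbar f) w = dzbar (dz f) w := by
  have d : ∀ i, DifferentiableAt ℝ (pd i f) w := fun i =>
    (contDiffAt_pd hf i).differentiableAt_of_infty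
  have e1 : ∀ i, pd i (dzbar f) w = 1 / 2 * (pd i (pd 0 f) w + Complex.I * pd i (pd 1 f) w) := by
    intro i
    rw [show dzbar f = fun x => (1 / 2) * (pd 0 f x + Complex.I * pd 1 f x) from rfl,
      pd_const_mul (f := fun x => pd 0 f x + Complex.I * pd 1 f x) _ ((d 0).add ((d 1).const_mul _)),
      pd_add (d 0) ((d 1).const_mul _),
      pd_const_mul _ (d 1)]
  have e2 : ∀ i, pd i (dz f) w = 1 / 2 * (pd i (pd 0 f) w - Complex.I * pd i (pd 1 f) w) := by
    intro i
    rw [show dz f = fun x => (1 / 2) * (pd 0 f x - Complex.I * pd 1 f x) from rfl,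
      pd_const_mul (f := fun x => pd 0 f x - Complex.I * pd 1 f x) _ ((d 0).sub ((d 1).const_mul _)),
      pd_sub (d 0) ((d 1).const_mul _),
      pd_const_mul _ (d 1)]
  rw [dz, dzbar, e1, e1, e2, e2, pd_comm hf 1 0]
  ring

end Rules

/-! ### Wirtinger derivatives of real functions -/

lemma pd_ofReal {u : ℂ → ℝ} {w : ℂ} (hu : DifferentiableAt ℝ u w) (i : Fin 2) :
    pd i (fun x => (u x : ℂ)) w = ((pd i u w : ℝ) : ℂ) := by
  have h : HasFDerivAt (fun x => (u x : ℂ)) (Complex.ofRealCLM.comp (fderiv ℝ u w)) w :=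
    Complex.ofRealCLM.hasFDerivAt.comp w hu.hasFDerivAt
  simp [pd, h.fderiv]

lemma dz_ofReal {u : ℂ → ℝ} {w : ℂ} (hu : DifferentiableAt ℝ u w) :
    dz (fun x => (u x : ℂ)) w = (1 / 2) * (((pd 0 u w : ℝ) : ℂ) - Complex.I * ((pd 1 u w : ℝ) : ℂ)) := by
  simp only [dz, pd_ofReal hu]

lemma dzbar_ofReal {u : ℂ → ℝ} {w : ℂ} (hu : DifferentiableAt ℝ u w) :
    dzbar (fun x => (u x : ℂ)) w = (1 / 2) * (((pd 0 u w : ℝ) : ℂ) + Complex.I * ((pd 1 u w : ℝ) : ℂ)) := by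
  simp only [dzbar, pd_ofReal hu]

lemma dzbar_ofReal_eq_star {u : ℂ → ℝ} {w : ℂ} (hu : DifferentiableAt ℝ u w) :
    dzbar (fun x => (u x : ℂ)) w = (starRingEnd ℂ) (dz (fun x => (u x : ℂ)) w) := by
  rw [dz_ofReal hu, dzbar_ofReal hu]; simp [Complex.conj_ofNat]

lemma contDiffAt_ofReal {u : ℂ → ℝ} {w : ℂ} (hu : ContDiffAt ℝ ∞ u w) :
    ContDiffAt ℝ ∞ (fun x => (u x : ℂ)) w :=
  Complex.ofRealCLM.contDiff.contDiffAt.comp w hu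

lemma contDiffAt_star {f : ℂ → ℂ} {w : ℂ} (hf : ContDiffAt ℝ ∞ f w) :
    ContDiffAt ℝ ∞ (fun x => (starRingEnd ℂ) (f x)) w :=
  (Complex.conjCLE : ℂ →L[ℝ] ℂ).contDiff.contDiffAt.comp w hf

/-! ### Connection, Laplacian, Hessian and curvature of ρ|dz|² -/

section Conformal

variable {ρ : ℂ → ℝ} {w : ℂ}

/-- No positivity is needed: at ρ = 0 the matrix inverse and the scalar inverse both take the value
zero. -/
lemma confMatrix_inv (w : ℂ) (k l : Fin 2) :
    (confMatrix ρ w)⁻¹ k l = if k = l then (ρ w)⁻¹ else 0 := by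
  have h : (confMatrix ρ w)⁻¹ = (ρ w)⁻¹ • (1 : Matrix (Fin 2) (Fin 2) ℝ) := by
    rcases eq_or_ne (ρ w) 0 with h0 | h0
    · simp [confMatrix, h0]
    · apply Matrix.inv_eq_right_inv
      simp [confMatrix, smul_smul, h0]
  rw [h, Matrix.smul_apply, Matrix.one_apply]
  split_ifs <;> simp

lemma pd_confMatrix (w : ℂ) (m i j : Fin 2) :
    pd m (fun x => confMatrix ρ x i j) w = if i = j then pd m ρ w else 0 := by
  by_cases h : i = j
  · subst h; simp [confMatrix]
  · simp [confMatrix, h, pd]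

/-- Christoffel symbols of a conformal metric. -/
lemma christoffel_conf (w : ℂ) (k i j : Fin 2) :
    christoffel (confMatrix ρ) k i j w = (1 / 2) * (ρ w)⁻¹ *
      ((if j = k then pd i ρ w else 0) + (if i = k then pd j ρ w else 0)
        - (if i = j then pd k ρ w else 0)) := by
  simp only [christoffel, confMatrix_inv, pd_confMatrix, ite_mul, zero_mul, Finset.sum_ite_eq,
    Finset.mem_univ, if_true]
  ring

lemma connForm_conf (hρ : 0 < ρ w) :
    connForm ρ 0 w = -(1 / 2) * (ρ w)⁻¹ * pd 1 ρ w ∧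
      connForm ρ 1 w = (1 / 2) * (ρ w)⁻¹ * pd 0 ρ w := by
  have hs : Real.sqrt (ρ w) ≠ 0 := (Real.sqrt_pos.2 hρ).ne'
  have hsq : Real.sqrt (ρ w) * Real.sqrt (ρ w) = ρ w := Real.mul_self_sqrt hρ.le
  have hz : ∀ j, pd j (fun _ : ℂ => (0 : ℝ)) w = 0 := by intro j; simp [pd]
  have hz' : ∀ j, pd j (frame ρ 0 1) w = 0 := fun j => by
    rw [← hz j]; congr 1
  -- Differentiating the factor ρ^{-1/2} of e₀ gives a multiple of e₀, which is orthogonal to e₁.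
  -- Only the Christoffel symbol is left.
  have key : ∀ j, connForm ρ j w = christoffel (confMatrix ρ) 1 j 0 w := by
    intro j
    simp only [connForm, covDeriv, Fin.sum_univ_two, hz']
    simp [frame, confMatrix]
    field_simp
    rw [Real.sq_sqrt hρ.le]
    ring
  constructor <;> rw [key, christoffel_conf] <;> simp

/-- In dimension two the first-order Christoffel terms cancel in the trace. -/
lemma laplacian_conf (u : ℂ → ℝ) (w : ℂ) :
    laplacian (confMatrix ρ) u w = (ρ w)⁻¹ * (pd 0 (pd 0 u) w + pd 1 (pd 1 u) w) := by
  simp [laplacian, confMatrix_inv, Fin.sum_univ_two, hessian, christoffel_conf]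
  ring

/-- `∂_z log ρ`. -/
noncomputable def dzLog (ρ : ℂ → ℝ) (w : ℂ) : ℂ := dz (fun x => (ρ x : ℂ)) w * ((ρ w : ℂ))⁻¹

lemma dz_eq_dzLog_mul (hρ : ρ w ≠ 0) :
    dz (fun x => (ρ x : ℂ)) w = dzLog ρ w * ρ w := by
  have : (ρ w : ℂ) ≠ 0 := mod_cast hρ
  rw [dzLog]; field_simp

lemma contDiffAt_inv_ofReal (hρ : ContDiffAt ℝ ∞ ρ w) (h0 : ρ w ≠ 0) :
    ContDiffAt ℝ ∞ (fun x => ((ρ x : ℂ))⁻¹) w := by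
  have := contDiffAt_ofReal (hρ.inv h0)
  simpa using this

lemma contDiffAt_dzLog (hρ : ContDiffAt ℝ ∞ ρ w) (h0 : ρ w ≠ 0) :
    ContDiffAt ℝ ∞ (dzLog ρ) w :=
  (contDiffAt_dz (contDiffAt_ofReal hρ)).mul (contDiffAt_inv_ofReal hρ h0)

/-- Smoothness is assumed on an open set because the formula for ∂_z u in terms of real partial
derivatives is itself differentiated. The mixed partial derivatives then cancel. -/
lemma dzbar_dz_ofReal {u : ℂ → ℝ} {s : Set ℂ} (hs : IsOpen s) (hu : ∀ x ∈ s, ContDiffAt ℝ ∞ u x)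
    (hw : w ∈ s) :
    dzbar (dz (fun x => (u x : ℂ))) w =
      (1 / 4) * ((pd 0 (pd 0 u) w + pd 1 (pd 1 u) w : ℝ) : ℂ) := by
  have e : dz (fun x => (u x : ℂ)) =ᶠ[𝓝 w]
      fun x => (1 / 2) * (((pd 0 u x : ℝ) : ℂ) - Complex.I * ((pd 1 u x : ℝ) : ℂ)) := by
    filter_upwards [hs.mem_nhds hw] with x hx
    exact dz_ofReal (hu x hx).differentiableAt_of_infty
  have d : ∀ i, DifferentiableAt ℝ (pd i u) w := fun i =>
    (contDiffAt_pd (hu w hw) i).differentiableAt_of_infty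
  have d' : ∀ i, DifferentiableAt ℝ (fun x => ((pd i u x : ℝ) : ℂ)) w := fun i =>
    (contDiffAt_ofReal (contDiffAt_pd (hu w hw) i)).differentiableAt_of_infty
  rw [dzbar_congr e,
    dzbar_const_mul (f := fun x => ((pd 0 u x : ℝ) : ℂ) - Complex.I * ((pd 1 u x : ℝ) : ℂ)) _
      ((d' 0).sub ((d' 1).const_mul _)),
    dzbar_sub (d' 0) ((d' 1).const_mul _), dzbar_const_mul _ (d' 1), dzbar_ofReal (d 0),
    dzbar_ofReal (d 1), pd_comm (hu w hw) 1 0]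
  push_cast
  linear_combination (-(1 / 4) * ((pd 1 (pd 1 u) w : ℝ) : ℂ)) * Complex.I_sq

lemma laplacian_eq_dzbar_dz {u : ℂ → ℝ} {s : Set ℂ} (hs : IsOpen s)
    (hu : ∀ x ∈ s, ContDiffAt ℝ ∞ u x) (hw : w ∈ s) (h0 : ρ w ≠ 0) :
    dzbar (dz (fun x => (u x : ℂ))) w =
      (1 / 4) * (ρ w : ℂ) * ((laplacian (confMatrix ρ) u w : ℝ) : ℂ) := by
  have h0' : (ρ w : ℂ) ≠ 0 := mod_cast h0
  rw [dzbar_dz_ofReal hs hu hw, laplacian_conf]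
  push_cast
  field_simp

/-- In complex coordinates the only Christoffel symbol contributing to (∂_z, ∂_z) is Γ^z_{zz} = ∂_z
log ρ. -/
lemma hessian_eq_dz_dz {u : ℂ → ℝ} {s : Set ℂ} (hs : IsOpen s)
    (hu : ∀ x ∈ s, ContDiffAt ℝ ∞ u x) (hw : w ∈ s) (hρ : DifferentiableAt ℝ ρ w) :
    (1 / 4) * (((hessian (confMatrix ρ) u 0 0 w : ℝ) : ℂ)
      - ((hessian (confMatrix ρ) u 1 1 w : ℝ) : ℂ)
      - Complex.I * (((hessian (confMatrix ρ) u 0 1 w : ℝ) : ℂ)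
        + ((hessian (confMatrix ρ) u 1 0 w : ℝ) : ℂ))) =
    dz (dz (fun x => (u x : ℂ))) w - dzLog ρ w * dz (fun x => (u x : ℂ)) w := by
  have e : dz (fun x => (u x : ℂ)) =ᶠ[𝓝 w]
      fun x => (1 / 2) * (((pd 0 u x : ℝ) : ℂ) - Complex.I * ((pd 1 u x : ℝ) : ℂ)) := by
    filter_upwards [hs.mem_nhds hw] with x hx
    exact dz_ofReal (hu x hx).differentiableAt_of_infty
  have d : ∀ i, DifferentiableAt ℝ (pd i u) w := fun i =>
    (contDiffAt_pd (hu w hw) i).differentiableAt_of_infty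
  have d' : ∀ i, DifferentiableAt ℝ (fun x => ((pd i u x : ℝ) : ℂ)) w := fun i =>
    (contDiffAt_ofReal (contDiffAt_pd (hu w hw) i)).differentiableAt_of_infty
  rw [dz_congr e,
    dz_const_mul (f := fun x => ((pd 0 u x : ℝ) : ℂ) - Complex.I * ((pd 1 u x : ℝ) : ℂ)) _
      ((d' 0).sub ((d' 1).const_mul _)),
    dz_sub (d' 0) ((d' 1).const_mul _), dz_const_mul _ (d' 1), dz_ofReal (d 0),
    dz_ofReal (d 1), pd_comm (hu w hw) 1 0, dzLog, dz_ofReal hρ,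
    dz_ofReal (hu w hw).differentiableAt_of_infty]
  simp only [hessian, Fin.sum_univ_two, christoffel_conf, pd_comm (hu w hw) 1 0]
  simp
  linear_combination (-(1 / 4) * ((pd 1 (pd 1 u) w : ℝ) : ℂ)
    + (1 / 4) * (ρ w : ℂ)⁻¹ * ((pd 1 ρ w : ℝ) : ℂ) * ((pd 1 u w : ℝ) : ℂ)) * Complex.I_sq

/-- The Gaussian curvature of `ρ |dz|²` is `-(2/ρ) ∂_z̄ ∂_z log ρ`. -/
lemma curvature_eq_dzbar_dzLog {s : Set ℂ} (hs : IsOpen s) (hρ : ∀ x ∈ s, ContDiffAt ℝ ∞ ρ x)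
    (h0 : ∀ x ∈ s, ρ x ≠ 0) (hw : w ∈ s) :
    dzbar (dzLog ρ) w = -(1 / 2) * (ρ w : ℂ) * ((curvature (confMatrix ρ) w : ℝ) : ℂ) := by
  have h0w := h0 w hw
  have h0' : (ρ w : ℂ) ≠ 0 := mod_cast h0w
  have di : DifferentiableAt ℝ (fun x => (ρ x)⁻¹) w :=
    ((hρ w hw).inv h0w).differentiableAt_of_infty
  have dp : ∀ i, DifferentiableAt ℝ (pd i ρ) w := fun i =>
    (contDiffAt_pd (hρ w hw) i).differentiableAt_of_infty
  have pdinv : ∀ i, pd i (fun x => (ρ x)⁻¹) w = -pd i ρ w * (ρ w)⁻¹ ^ 2 := by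
    intro i
    have := ((hasDerivAt_inv h0w).comp_hasFDerivAt w (hρ w hw).differentiableAt_of_infty.hasFDerivAt)
    rw [pd, pd, show (fun x => (ρ x)⁻¹) = Inv.inv ∘ ρ from rfl, this.fderiv]
    simp; ring
  -- Constant coefficients a, b, c stand for the Kronecker deltas of `christoffel_conf`, so one
  -- differentiation covers all the Christoffel symbols.
  have pdr : ∀ (a b c : ℝ) (m i j k : Fin 2), pd m (fun x => (1 / 2) * (ρ x)⁻¹ *
      (a * pd i ρ x + b * pd j ρ x - c * pd k ρ x)) w =
      (1 / 2) * ((-pd m ρ w * (ρ w)⁻¹ ^ 2) *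
        (a * pd i ρ w + b * pd j ρ w - c * pd k ρ w) + (ρ w)⁻¹ *
        (a * pd m (pd i ρ) w + b * pd m (pd j ρ) w - c * pd m (pd k ρ) w)) := by
    intro a b c m i j k
    rw [← pdinv]
    have hh := ((di.hasFDerivAt.const_mul (1 / 2)).mul ((((dp i).hasFDerivAt.const_mul a).add
      ((dp j).hasFDerivAt.const_mul b)).sub ((dp k).hasFDerivAt.const_mul c)))
    have := congrArg (fun L => L (coordVec m)) hh.fderiv
    simp only [pd] at this ⊢
    refine this.trans ?_
    simp
    ring
  have pdc : ∀ m k i j : Fin 2, pd m (christoffel (confMatrix ρ) k i j) w =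
      (1 / 2) * ((-pd m ρ w * (ρ w)⁻¹ ^ 2) *
        ((if j = k then 1 else 0) * pd i ρ w + (if i = k then 1 else 0) * pd j ρ w
          - (if i = j then 1 else 0) * pd k ρ w) + (ρ w)⁻¹ *
        ((if j = k then 1 else 0) * pd m (pd i ρ) w + (if i = k then 1 else 0) * pd m (pd j ρ) w
          - (if i = j then 1 else 0) * pd m (pd k ρ) w)) := by
    intro m k i j
    rw [← pdr]
    congr 1
    funext x
    rw [christoffel_conf]
    simp
  have dR : DifferentiableAt ℝ (fun x => (ρ x : ℂ)) w :=
    (contDiffAt_ofReal (hρ w hw)).differentiableAt_of_infty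
  have dRi := (contDiffAt_inv_ofReal (hρ w hw) h0w).differentiableAt_of_infty
  have ei : dzbar (fun x => ((ρ x : ℂ))⁻¹) w =
      -dzbar (fun x => (ρ x : ℂ)) w * ((ρ w : ℂ))⁻¹ ^ 2 := by
    have hh : (fun x => ((ρ x : ℂ))⁻¹) = fun x => (((ρ x)⁻¹ : ℝ) : ℂ) := by
      funext x; push_cast; rfl
    rw [hh, dzbar_ofReal di, dzbar_ofReal (hρ w hw).differentiableAt_of_infty, pdinv, pdinv]
    push_cast; ring
  rw [show dzLog ρ = fun x => dz (fun x => (ρ x : ℂ)) x * ((ρ x : ℂ))⁻¹ from rfl,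
    dzbar_mul (contDiffAt_dz (contDiffAt_ofReal (hρ w hw))).differentiableAt_of_infty dRi, ei,
    dzbar_dz_ofReal hs hρ hw, dzbar_ofReal (hρ w hw).differentiableAt_of_infty,
    dz_ofReal (hρ w hw).differentiableAt_of_infty]
  have hdet : (confMatrix ρ w).det = ρ w ^ 2 := by
    simp [confMatrix]
  simp only [curvature, riemann, Fin.sum_univ_two, hdet, pdc, christoffel_conf,
    pd_comm (hρ w hw) 1 0]
  simp [confMatrix]
  field_simp
  ring_nf
  simp only [Complex.I_sq]
  ring

end Conformal

/-! ### Spin connection and Dirac operator in components -/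

section Spinor

variable {ρ : ℂ → ℝ} {φ : ℂ → Fin 2 → ℂ} {w : ℂ}

/-- Both sides equal i Im(Lv) with L = ∂_z log ρ. This expresses the connection form by the same
quantity L that appears in the Hessian and the curvature. -/
lemma connForm_eq_im (hρ : 0 < ρ w) (hd : DifferentiableAt ℝ ρ w) (v : ℂ) :
    (((v.re * connForm ρ 0 w + v.im * connForm ρ 1 w : ℝ) : ℂ)) * Complex.I =
      (1 / 2) * (dzLog ρ w * v - (starRingEnd ℂ) (dzLog ρ w) * (starRingEnd ℂ) v) := by
  rw [(connForm_conf hρ).1, (connForm_conf hρ).2, dzLog, dz_ofReal hd]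
  apply Complex.ext
  · simp [← Complex.ofReal_inv]
  · simp [← Complex.ofReal_inv]; ring

/-- The product e₀ · e₁ acts as diag(i, -i), so the connection contributes ±¼(Lv - L̄v̄), with the
plus sign on this component and the minus sign on the other. -/
lemma spinDeriv_apply_zero (hρ : 0 < ρ w) (hd : DifferentiableAt ℝ ρ w)
    (hφ : DifferentiableAt ℝ φ w) (v : ℂ) :
    spinDeriv ρ φ w v 0 =
      (dz (fun x => φ x 0) w + (1 / 4) * dzLog ρ w * φ w 0) * v +
      (dzbar (fun x => φ x 0) w - (1 / 4) * (starRingEnd ℂ) (dzLog ρ w) * φ w 0) *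
        (starRingEnd ℂ) v := by
  have h := fderiv_apply hφ 0
  have h1 : fderiv ℝ φ w v 0 = fderiv ℝ (fun x => φ x 0) w v := by rw [h]; rfl
  have h2 := connForm_eq_im hρ hd v
  have h3 : (gam 0 * gam 1).mulVec (φ w) 0 = Complex.I * φ w 0 := by
    simp [gam, Matrix.mulVec, dotProduct, Fin.sum_univ_two, Matrix.mul_apply]
  rw [spinDeriv, Pi.add_apply, Pi.smul_apply, h1, h3, fderiv_eq_dz_dzbar, smul_eq_mul]
  rw [Complex.ofReal_mul]
  push_cast at h2 ⊢
  linear_combination (1 / 2) * φ w 0 * h2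

lemma spinDeriv_apply_one (hρ : 0 < ρ w) (hd : DifferentiableAt ℝ ρ w)
    (hφ : DifferentiableAt ℝ φ w) (v : ℂ) :
    spinDeriv ρ φ w v 1 =
      (dz (fun x => φ x 1) w - (1 / 4) * dzLog ρ w * φ w 1) * v +
      (dzbar (fun x => φ x 1) w + (1 / 4) * (starRingEnd ℂ) (dzLog ρ w) * φ w 1) *
        (starRingEnd ℂ) v := by
  have h := fderiv_apply hφ 1
  have h1 : fderiv ℝ φ w v 1 = fderiv ℝ (fun x => φ x 1) w v := by rw [h]; rfl
  have h2 := connForm_eq_im hρ hd v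
  have h3 : (gam 0 * gam 1).mulVec (φ w) 1 = -Complex.I * φ w 1 := by
    simp [gam, Matrix.mulVec, dotProduct, Fin.sum_univ_two, Matrix.mul_apply]
  rw [spinDeriv, Pi.add_apply, Pi.smul_apply, h1, h3, fderiv_eq_dz_dzbar, smul_eq_mul]
  rw [Complex.ofReal_mul]
  push_cast at h2 ⊢
  linear_combination -(1 / 2) * φ w 1 * h2

/-- The Dirac equation in isothermal coordinates. -/
lemma dz_components_of_dirac (hρ : 0 < ρ w) (hd : DifferentiableAt ℝ ρ w)
    (hφ : DifferentiableAt ℝ φ w) {E : ℂ} (h : dirac ρ φ w = -E • φ w) :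
    dzbar (fun x => φ x 1) w = -(1 / 4) * (starRingEnd ℂ) (dzLog ρ w) * φ w 1
        - (1 / 2) * (Real.sqrt (ρ w) : ℂ) * E * φ w 0 ∧
      dz (fun x => φ x 0) w = -(1 / 4) * dzLog ρ w * φ w 0
        + (1 / 2) * (Real.sqrt (ρ w) : ℂ) * E * φ w 1 := by
  have hs : (Real.sqrt (ρ w) : ℂ) ≠ 0 := mod_cast (Real.sqrt_pos.2 hρ).ne'
  have e0 := congrFun h 0
  have e1 := congrFun h 1
  simp only [dirac, Fin.sum_univ_two, Pi.add_apply, Matrix.mulVec, dotProduct,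
    spinDeriv_apply_zero hρ hd hφ, spinDeriv_apply_one hρ hd hφ] at e0 e1
  simp [gam, frame, coordVec] at e0 e1
  field_simp at e0 e1
  rw [Complex.I_sq] at e0 e1
  constructor
  · linear_combination (1 / 8) * e0
  · linear_combination -(1 / 8) * e1

/-- The bilinear expression `∂_z φ₁ φ̄₀ - φ₁ ∂_z φ̄₀`. -/
noncomputable def spinWronskian (φ : ℂ → Fin 2 → ℂ) (w : ℂ) : ℂ :=
  dz (fun x => φ x 1) w * (starRingEnd ℂ) (φ w 0)
    - φ w 1 * dz (fun x => (starRingEnd ℂ) (φ x 0)) w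

/-- Clifford multiplication by dz and by dz̄ is nilpotent, so only ∂_z̄φ₀ (conjugated) and ∂_zφ₁
enter. Their connection terms ∓¼Lφ₁φ̄₀ cancel, without use of the Dirac equation. The factor d is
the derivative of a holomorphic change of coordinate: X and Y = iX are the images of the two
coordinate vectors. -/
lemma spinorTerm_coord (hρ : 0 < ρ w) (hd : DifferentiableAt ℝ ρ w)
    (hφ : DifferentiableAt ℝ φ w) (d : ℂ) {X Y : ℂ} (hX : X = d) (hY : Y = d * Complex.I) :
    herm (φ w) ((cliff ρ w X + Complex.I • cliff ρ w Y).mulVec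
        ((1 / 2 : ℂ) • (spinDeriv ρ φ w X + Complex.I • spinDeriv ρ φ w Y)))
      + herm ((cliff ρ w X - Complex.I • cliff ρ w Y).mulVec
        ((1 / 2 : ℂ) • (spinDeriv ρ φ w X - Complex.I • spinDeriv ρ φ w Y))) (φ w) =
    2 * (Real.sqrt (ρ w) : ℂ) * spinWronskian φ w * d ^ 2 := by
  subst hX hY
  have hp : DifferentiableAt ℝ (fun x => φ x 0) w := differentiableAt_pi.1 hφ 0
  have hc1 : cliff ρ w X + Complex.I • cliff ρ w (X * Complex.I) =
      (Real.sqrt (ρ w) : ℂ) • !![0, 0; -2 * (starRingEnd ℂ) X, 0] := by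
    ext i j
    fin_cases i <;> fin_cases j <;> apply Complex.ext <;> simp [cliff, gam] <;> ring
  have hc2 : cliff ρ w X - Complex.I • cliff ρ w (X * Complex.I) =
      (Real.sqrt (ρ w) : ℂ) • !![0, 2 * X; 0, 0] := by
    ext i j
    fin_cases i <;> fin_cases j <;> apply Complex.ext <;> simp [cliff, gam] <;> ring
  rw [hc1, hc2, spinWronskian, dz_star hp]
  simp only [herm, Matrix.mulVec, dotProduct, Fin.sum_univ_two, Pi.smul_apply, Pi.add_apply,
    Pi.sub_apply, spinDeriv_apply_zero hρ hd hφ, spinDeriv_apply_one hρ hd hφ, Matrix.smul_apply]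
  simp [Complex.conj_ofNat]
  ring_nf
  simp only [Complex.I_sq]
  ring

end Spinor

/-! ### The ∂_z̄-derivative of T in a coordinate -/

/-- Obtained by differentiating √ρ · √ρ = ρ and cancelling √ρ. -/
lemma dz_sqrt {ρ : ℂ → ℝ} {s : Set ℂ} {w : ℂ} (hs : IsOpen s) (hw : w ∈ s)
    (hρ : ∀ x ∈ s, ContDiffAt ℝ ∞ ρ x) (hpos : ∀ x ∈ s, 0 < ρ x) :
    dz (fun x => (Real.sqrt (ρ x) : ℂ)) w = (1 / 2) * dzLog ρ w * (Real.sqrt (ρ w) : ℂ) := by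
  have hd : DifferentiableAt ℝ (fun x => (Real.sqrt (ρ x) : ℂ)) w :=
    (contDiffAt_ofReal ((hρ w hw).sqrt (hpos w hw).ne')).differentiableAt_of_infty
  have hne : (Real.sqrt (ρ w) : ℂ) ≠ 0 := mod_cast (Real.sqrt_pos.2 (hpos w hw)).ne'
  have hsq : ∀ x ∈ s, (ρ x : ℂ) = (Real.sqrt (ρ x) : ℂ) * (Real.sqrt (ρ x) : ℂ) := by
    intro x hx
    rw [← Complex.ofReal_mul, Real.mul_self_sqrt (hpos x hx).le]
  have e : (fun x => (ρ x : ℂ)) =ᶠ[𝓝 w]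
      fun x => (Real.sqrt (ρ x) : ℂ) * (Real.sqrt (ρ x) : ℂ) := by
    filter_upwards [hs.mem_nhds hw] with x hx using hsq x hx
  have h1 := dz_congr e
  rw [dz_mul hd hd, dz_eq_dzLog_mul (hpos w hw).ne', hsq w hw] at h1
  apply mul_right_cancel₀ hne
  linear_combination -(1 / 2) * h1

/-- The `∂_z̄`-derivative of the spinor part of the quadratic differential. -/
lemma dzbar_sqrt_mul_spinWronskian {ρ u : ℂ → ℝ} {φ : ℂ → Fin 2 → ℂ} {s : Set ℂ} {w : ℂ}
    (hs : IsOpen s) (hw : w ∈ s)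
    (hρ : ∀ x ∈ s, ContDiffAt ℝ ∞ ρ x) (hpos : ∀ x ∈ s, 0 < ρ x)
    (hu : ∀ x ∈ s, ContDiffAt ℝ ∞ u x) (hφ : ∀ x ∈ s, ContDiffAt ℝ ∞ φ x)
    (hD : ∀ x ∈ s, dirac ρ φ x = -((Real.exp (u x) : ℝ) : ℂ) • φ x) :
    dzbar (fun x => (Real.sqrt (ρ x) : ℂ) * spinWronskian φ x) w =
      (1 / 2) * (ρ w : ℂ) * ((Real.exp (u w) : ℝ) : ℂ) *
        (dz (fun x => herm (φ x) (φ x)) w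
          - dz (fun x => (u x : ℂ)) w * herm (φ w) (φ w)) := by
  set p : ℂ → ℂ := fun x => φ x 0 with hp
  set b : ℂ → ℂ := fun x => φ x 1 with hb
  set p' : ℂ → ℂ := fun x => (starRingEnd ℂ) (φ x 0) with hp'
  set b' : ℂ → ℂ := fun x => (starRingEnd ℂ) (φ x 1) with hb'
  set σ : ℂ → ℂ := fun x => (Real.sqrt (ρ x) : ℂ) with hσ
  set L : ℂ → ℂ := dzLog ρ with hL
  set L' : ℂ → ℂ := fun x => (starRingEnd ℂ) (dzLog ρ x) with hL'
  set U : ℂ → ℂ := fun x => (u x : ℂ) with hU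
  set C : ℂ → ℂ := fun x => σ x * Complex.exp (U x) with hC
  have cp : ∀ x ∈ s, ContDiffAt ℝ ∞ p x := fun x hx => contDiffAt_pi.1 (hφ x hx) 0
  have cb : ∀ x ∈ s, ContDiffAt ℝ ∞ b x := fun x hx => contDiffAt_pi.1 (hφ x hx) 1
  have cp' : ∀ x ∈ s, ContDiffAt ℝ ∞ p' x := fun x hx => contDiffAt_star (cp x hx)
  have cb' : ∀ x ∈ s, ContDiffAt ℝ ∞ b' x := fun x hx => contDiffAt_star (cb x hx)
  have cσ : ∀ x ∈ s, ContDiffAt ℝ ∞ σ x := fun x hx =>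
    contDiffAt_ofReal ((hρ x hx).sqrt (hpos x hx).ne')
  have cL : ∀ x ∈ s, ContDiffAt ℝ ∞ L x := fun x hx => contDiffAt_dzLog (hρ x hx) (hpos x hx).ne'
  have cL' : ∀ x ∈ s, ContDiffAt ℝ ∞ L' x := fun x hx => contDiffAt_star (cL x hx)
  have cU : ∀ x ∈ s, ContDiffAt ℝ ∞ U x := fun x hx => contDiffAt_ofReal (hu x hx)
  have cC : ∀ x ∈ s, ContDiffAt ℝ ∞ C x := fun x hx => (cσ x hx).mul (cU x hx).cexp
  have hexp : ∀ x, ((Real.exp (u x) : ℝ) : ℂ) = Complex.exp (U x) := fun x => by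
    rw [Complex.ofReal_exp]
  have eqs : ∀ x ∈ s, dzbar b x = -(1 / 4) * L' x * b x - (1 / 2) * C x * p x ∧
      dz p x = -(1 / 4) * L x * p x + (1 / 2) * C x * b x := by
    intro x hx
    have := dz_components_of_dirac (hpos x hx) (hρ x hx).differentiableAt_of_infty
      (hφ x hx).differentiableAt_of_infty (hD x hx)
    rw [hexp] at this
    refine ⟨this.1.trans ?_, this.2.trans ?_⟩ <;> simp only [hC, hσ, hL, hL', hp, hb] <;> ring
  have hCc : ∀ x, (starRingEnd ℂ) (C x) = C x := fun x => by
    simp [hC, hσ, hU, ← Complex.exp_conj]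
  -- The coupling C = √ρ e^u is real, so conjugating the Dirac system gives equations for φ̄₀ and
  -- φ̄₁ with the same C.
  have eqs' : ∀ x ∈ s, dz b' x = -(1 / 4) * L x * b' x - (1 / 2) * C x * p' x ∧
      dzbar p' x = -(1 / 4) * L' x * p' x + (1 / 2) * C x * b' x := by
    intro x hx
    constructor
    · rw [hb', dz_star (cb x hx).differentiableAt_of_infty, (eqs x hx).1]
      simp [hCc, hL', hp', hb, hp, hL, Complex.conj_ofNat]
    · rw [hp', dzbar_star (cp x hx).differentiableAt_of_infty, (eqs x hx).2]
      simp [hCc, hL', hb', hb, hp, hL, Complex.conj_ofNat]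
  have D : ∀ {f : ℂ → ℂ}, (∀ x ∈ s, ContDiffAt ℝ ∞ f x) → DifferentiableAt ℝ f w :=
    fun hf => (hf w hw).differentiableAt_of_infty
  have e1 : dzbar (dz b) w = -(1 / 4) * (dz L' w * b w + L' w * dz b w)
      - (1 / 2) * (dz C w * p w + C w * dz p w) := by
    have e : dzbar b =ᶠ[𝓝 w] fun x => (-(1 / 4)) * (L' x * b x) - (1 / 2) * (C x * p x) := by
      filter_upwards [hs.mem_nhds hw] with x hx
      rw [(eqs x hx).1]; ring
    rw [← dz_dzbar_comm (cb w hw), dz_congr e,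
      dz_sub (((D cL').fun_mul (D cb)).const_mul _) (((D cC).fun_mul (D cp)).const_mul _),
      dz_const_mul (f := fun x => L' x * b x) _ ((D cL').mul (D cb)),
      dz_const_mul (f := fun x => C x * p x) _ ((D cC).mul (D cp)),
      dz_mul (D cL') (D cb), dz_mul (D cC) (D cp)]
  have e2 : dzbar (dz p') w = -(1 / 4) * (dz L' w * p' w + L' w * dz p' w)
      + (1 / 2) * (dz C w * b' w + C w * dz b' w) := by
    have e : dzbar p' =ᶠ[𝓝 w] fun x => (-(1 / 4)) * (L' x * p' x) + (1 / 2) * (C x * b' x) := by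
      filter_upwards [hs.mem_nhds hw] with x hx
      rw [(eqs' x hx).2]; ring
    rw [← dz_dzbar_comm (cp' w hw), dz_congr e,
      dz_add (((D cL').fun_mul (D cp')).const_mul _) (((D cC).fun_mul (D cb')).const_mul _),
      dz_const_mul (f := fun x => L' x * p' x) _ ((D cL').mul (D cp')),
      dz_const_mul (f := fun x => C x * b' x) _ ((D cC).mul (D cb')),
      dz_mul (D cL') (D cp'), dz_mul (D cC) (D cb')]
  have eσ : dz σ w = (1 / 2) * L w * σ w := dz_sqrt hs hw hρ hpos
  have eσ' : dzbar σ w = (1 / 2) * L' w * σ w := by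
    rw [hσ, dzbar_ofReal_eq_star ((hρ w hw).sqrt (hpos w hw).ne').differentiableAt_of_infty, eσ]
    simp [hσ, hL', hL, Complex.conj_ofNat]
  have eC : dz C w = ((1 / 2) * L w + dz U w) * C w := by
    rw [hC, dz_mul (D cσ) (D fun x hx => (cU x hx).cexp),
      dz_hasDerivAt_comp (Complex.hasDerivAt_exp _) (D cU), eσ]
    ring
  have eN : dz (fun x => herm (φ x) (φ x)) w =
      dz p w * p' w + p w * dz p' w + (dz b w * b' w + b w * dz b' w) := by
    have : (fun x => herm (φ x) (φ x)) = fun x => p x * p' x + b x * b' x := by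
      funext x; simp [herm, Fin.sum_univ_two, hp, hp', hb, hb']
    rw [this, dz_add ((D cp).fun_mul (D cp')) ((D cb).fun_mul (D cb')), dz_mul (D cp) (D cp'),
      dz_mul (D cb) (D cb')]
  have eV : dzbar (spinWronskian φ) w = dzbar (dz b) w * p' w + dz b w * dzbar p' w
      - (dzbar b w * dz p' w + b w * dzbar (dz p') w) := by
    have : spinWronskian φ = fun x => dz b x * p' x - b x * dz p' x := rfl
    have c1 := D fun x hx => contDiffAt_dz (cb x hx)
    have c2 := D fun x hx => contDiffAt_dz (cp' x hx)
    rw [this, dzbar_sub (c1.fun_mul (D cp')) ((D cb).fun_mul c2), dzbar_mul c1 (D cp'),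
      dzbar_mul (D cb) c2]
  have cV : DifferentiableAt ℝ (spinWronskian φ) w :=
    (((contDiffAt_dz (cb w hw)).mul (cp' w hw)).sub
      ((cb w hw).mul (contDiffAt_dz (cp' w hw)))).differentiableAt_of_infty
  have hR : (ρ w : ℂ) = σ w * σ w := by
    rw [hσ, ← Complex.ofReal_mul, Real.mul_self_sqrt (hpos w hw).le]
  have hN : herm (φ w) (φ w) = p w * p' w + b w * b' w := by
    simp [herm, Fin.sum_univ_two, hp, hp', hb, hb']
  have hV : spinWronskian φ w = dz b w * p' w - b w * dz p' w := rfl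
  -- After substitution the terms containing ∂_z L̄ cancel in the Wronskian, and the L̄ terms cancel
  -- against ∂_z̄√ρ. The remaining factor √ρ · C equals ρe^u.
  rw [dzbar_mul (D cσ) cV, eσ', eV, e1, e2, eC, eN, hN, hR, hexp, hV, (eqs w hw).1, (eqs w hw).2,
    (eqs' w hw).1, (eqs' w hw).2]
  simp only [hC]
  ring

/-- Smoothness of the Gaussian curvature of a conformal metric. -/
lemma contDiffAt_curvature {ρ : ℂ → ℝ} {s : Set ℂ} {w : ℂ} (hs : IsOpen s) (hw : w ∈ s)
    (hρ : ∀ x ∈ s, ContDiffAt ℝ ∞ ρ x) (hpos : ∀ x ∈ s, 0 < ρ x) :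
    ContDiffAt ℝ ∞ (fun x => ((curvature (confMatrix ρ) x : ℝ) : ℂ)) w := by
  -- Solving `curvature_eq_dzbar_dzLog` for the curvature exhibits it as a smooth expression in ρ.
  have e : (fun x => ((curvature (confMatrix ρ) x : ℝ) : ℂ)) =ᶠ[𝓝 w]
      fun x => (-2) * ((ρ x : ℂ)⁻¹ * dzbar (dzLog ρ) x) := by
    filter_upwards [hs.mem_nhds hw] with x hx
    have : (ρ x : ℂ) ≠ 0 := mod_cast (hpos x hx).ne'
    rw [curvature_eq_dzbar_dzLog hs hρ (fun y hy => (hpos y hy).ne') hx]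
    field_simp
  exact (contDiffAt_const.mul ((contDiffAt_inv_ofReal (hρ w hw) (hpos w hw).ne').mul
    (contDiffAt_dzbar (contDiffAt_dzLog (hρ w hw) (hpos w hw).ne')))).congr_of_eventuallyEq e

/-- The `∂_z̄`-derivative of the quadratic differential in an isothermal coordinate, given the
`∂_z̄`-derivative of its spinor part `Q`. -/
lemma dzbar_quadratic {ρ u n : ℂ → ℝ} {Q : ℂ → ℂ} {s : Set ℂ} {w : ℂ}
    (hs : IsOpen s) (hw : w ∈ s)
    (hρ : ∀ x ∈ s, ContDiffAt ℝ ∞ ρ x) (hpos : ∀ x ∈ s, 0 < ρ x)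
    (hu : ∀ x ∈ s, ContDiffAt ℝ ∞ u x) (hn : ContDiffAt ℝ ∞ n w)
    (hQ : DifferentiableAt ℝ Q w)
    (hdQ : dzbar Q w = (1 / 4) * (ρ w : ℂ) * ((Real.exp (u w) : ℝ) : ℂ) *
      (dz (fun x => (n x : ℂ)) w - dz (fun x => (u x : ℂ)) w * n w))
    (hlap : ∀ x ∈ s, -laplacian (confMatrix ρ) u x =
      2 * Real.exp (2 * u x) - Real.exp (u x) * n x - curvature (confMatrix ρ) x) :
    dzbar (fun x => dz (fun x => (u x : ℂ)) x ^ 2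
        - (dz (dz (fun x => (u x : ℂ))) x - dzLog ρ x * dz (fun x => (u x : ℂ)) x) + Q x) w =
      -((ρ w : ℂ) / 4) * dz (fun x => ((curvature (confMatrix ρ) x : ℝ) : ℂ)) w := by
  set U : ℂ → ℂ := fun x => (u x : ℂ) with hU
  set R : ℂ → ℂ := fun x => (ρ x : ℂ) with hR
  set N : ℂ → ℂ := fun x => (n x : ℂ) with hN
  set K : ℂ → ℂ := fun x => ((curvature (confMatrix ρ) x : ℝ) : ℂ) with hK
  set A : ℂ → ℂ := dz U with hA
  set L : ℂ → ℂ := dzLog ρ with hL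
  set E : ℂ → ℂ := fun x => Complex.exp (U x) with hE
  set F : ℂ → ℂ := fun x => 2 * (E x * E x) - E x * N x - K x with hF
  have cU : ∀ x ∈ s, ContDiffAt ℝ ∞ U x := fun x hx => contDiffAt_ofReal (hu x hx)
  have dE : DifferentiableAt ℝ E w := (cU w hw).cexp.differentiableAt_of_infty
  have dK : DifferentiableAt ℝ K w := (contDiffAt_curvature hs hw hρ hpos).differentiableAt_of_infty
  have dR : DifferentiableAt ℝ R w := (contDiffAt_ofReal (hρ w hw)).differentiableAt_of_infty
  have dN : DifferentiableAt ℝ N w := (contDiffAt_ofReal hn).differentiableAt_of_infty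
  have cA := contDiffAt_dz (cU w hw)
  have dA : DifferentiableAt ℝ A w := cA.differentiableAt_of_infty
  have ddA : DifferentiableAt ℝ (dz A) w := (contDiffAt_dz cA).differentiableAt_of_infty
  have dL : DifferentiableAt ℝ L w :=
    (contDiffAt_dzLog (hρ w hw) (hpos w hw).ne').differentiableAt_of_infty
  have dF : DifferentiableAt ℝ F w := ((dE.mul dE).const_mul _).sub (dE.mul dN) |>.sub dK
  have eA : ∀ x ∈ s, dzbar A x = (-(1 / 4)) * (R x * F x) := by
    intro x hx
    rw [hA, hU, laplacian_eq_dzbar_dz hs hu hx (hpos x hx).ne', ← neg_neg (laplacian _ u x),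
      hlap x hx]
    simp only [hF, hR, hE, hN, hK, hU]
    push_cast
    rw [two_mul (u x : ℂ), Complex.exp_add]
    ring
  -- Here ∂_z̄∂_z A = ∂_z∂_z̄ A, and the Liouville equation, valid near the point, is differentiated
  -- once more.
  have eAA : dzbar (dz A) w = (-(1 / 4)) * (L w * R w * F w + R w * dz F w) := by
    have e : dzbar A =ᶠ[𝓝 w] fun x => (-(1 / 4)) * (R x * F x) := by
      filter_upwards [hs.mem_nhds hw] with x hx using eA x hx
    rw [← dz_dzbar_comm cA, dz_congr e, dz_const_mul (f := fun x => R x * F x) _ (dR.mul dF),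
      dz_mul dR dF, hR, dz_eq_dzLog_mul (hpos w hw).ne']
  have eE : dz E w = E w * A w := dz_hasDerivAt_comp (Complex.hasDerivAt_exp _)
    (cU w hw).differentiableAt_of_infty
  have eF : dz F w = 4 * E w * E w * A w - (E w * A w * N w + E w * dz N w) - dz K w := by
    have dEE : DifferentiableAt ℝ (fun x => E x * E x) w := dE.mul dE
    have dEN : DifferentiableAt ℝ (fun x => E x * N x) w := dE.mul dN
    rw [hF, dz_sub ((dEE.const_mul _).fun_sub dEN) dK, dz_sub (dEE.const_mul _) dEN,
      dz_const_mul _ dEE, dz_mul dE dE, dz_mul dE dN, eE]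
    ring
  have eL : dzbar L w = -(1 / 2) * R w * K w :=
    curvature_eq_dzbar_dzLog hs hρ (fun x hx => (hpos x hx).ne') hw
  have eQ : dzbar Q w = (1 / 4) * R w * E w * (dz N w - A w * N w) := by
    rw [hdQ, Complex.ofReal_exp]
  have split : (fun x => A x ^ 2 - (dz A x - L x * A x) + Q x) =
      fun x => (A x * A x - (dz A x - L x * A x)) + Q x := by
    funext x; ring
  have dLA : DifferentiableAt ℝ (fun x => L x * A x) w := dL.mul dA
  have dAA : DifferentiableAt ℝ (fun x => A x * A x) w := dA.mul dA
  rw [split, dzbar_add (dAA.fun_sub (ddA.fun_sub dLA)) hQ, dzbar_sub dAA (ddA.fun_sub dLA),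
    dzbar_sub ddA dLA, dzbar_mul dA dA, dzbar_mul dL dA, eAA, eA w hw, eL, eQ, eF]
  -- What remains is (ρ/4)(-2AF + ∂_zF - 2KA + e^u(∂_z n - A n)). The e^{2u}, n and KA terms cancel
  -- and leave -∂_zK.
  change _ = -(R w / 4) * dz K w
  simp only [hF]
  ring

/-! ### Square roots and holomorphic changes of coordinate -/

/-- A continuous square root of a nonvanishing differentiable function is differentiable. -/
lemma differentiableAt_of_sq_eq {s m : ℂ → ℂ} {q : ℂ} (hc : ContinuousAt s q) (h0 : s q ≠ 0)
    (hm : DifferentiableAt ℝ m q) (h : ∀ᶠ x in 𝓝 q, s x ^ 2 = m x) : DifferentiableAt ℝ s q := by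
  have hr : ContinuousAt (fun x => (s x / s q).re) q :=
    Complex.continuous_re.continuousAt.comp (hc.div_const _)
  have hpos : ∀ᶠ x in 𝓝 q, 0 < (s x / s q).re :=
    hr.eventually (lt_mem_nhds (by simp [div_self h0]))
  -- By continuity s(x)/s(q) has positive real part near q, so it is the principal square root of
  -- its square. That root is holomorphic near 1.
  have e : s =ᶠ[𝓝 q] fun x => s q * (m x / s q ^ 2) ^ (2⁻¹ : ℂ) := by
    filter_upwards [hpos, h] with x hx hx'
    rw [← hx', ← div_pow, Complex.sq_cpow_two_inv hx]
    field_simp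
  have h1 : m q / s q ^ 2 = 1 := by
    rw [← h.self_of_nhds]; field_simp
  have hF : DifferentiableAt ℂ (fun z : ℂ => z ^ (2⁻¹ : ℂ)) (m q / s q ^ 2) := by
    rw [h1]
    exact differentiableAt_id.cpow (differentiableAt_const _) (by simp)
  refine DifferentiableAt.congr_of_eventuallyEq ?_ e
  exact (DifferentiableAt.comp (f := fun x => m x / s q ^ 2) q (hF.restrictScalars ℝ)
    (by simpa only [div_eq_mul_inv] using hm.mul_const (s q ^ 2)⁻¹)).const_mul _

/-- Behaviour of `(∂_z u)² - ∂_z² u` under a holomorphic change of coordinates. -/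
lemma quadratic_comp {ρ ρ' u u' : ℂ → ℝ} {f : ℂ → ℂ} {w : ℂ} {s : Set ℂ}
    (hf : AnalyticAt ℂ f w) (hf' : deriv f w ≠ 0) (hs : IsOpen s) (hw : f w ∈ s)
    (hu' : ∀ x ∈ s, ContDiffAt ℝ ∞ u' x) (hρ' : ContDiffAt ℝ ∞ ρ' (f w)) (h0 : ρ' (f w) ≠ 0)
    (hu : ∀ᶠ x in 𝓝 w, u x = u' (f x))
    (hρ : ∀ᶠ x in 𝓝 w, ρ x = ρ' (f x) * ‖deriv f x‖ ^ 2) :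
    dz (fun x => (u x : ℂ)) w ^ 2
        - (dz (dz (fun x => (u x : ℂ))) w - dzLog ρ w * dz (fun x => (u x : ℂ)) w) =
      (dz (fun x => (u' x : ℂ)) (f w) ^ 2
        - (dz (dz (fun x => (u' x : ℂ))) (f w)
          - dzLog ρ' (f w) * dz (fun x => (u' x : ℂ)) (f w))) * deriv f w ^ 2 := by
  set d : ℂ → ℂ := deriv f with hd
  have hda : AnalyticAt ℂ d w := hf.deriv
  have hdd : HasDerivAt d (deriv d w) w := hda.differentiableAt.hasDerivAt
  have dd : DifferentiableAt ℝ d w := hda.differentiableAt.restrictScalars ℝ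
  have dds : DifferentiableAt ℝ (fun x => (starRingEnd ℂ) (d x)) w :=
    (Complex.conjCLE : ℂ →L[ℝ] ℂ).differentiableAt.comp w dd
  have hfd : HasDerivAt f (d w) w := hf.differentiableAt.hasDerivAt
  have cA' := contDiffAt_dz (contDiffAt_ofReal (hu' _ hw))
  have dA' := cA'.differentiableAt_of_infty
  have dR' := (contDiffAt_ofReal hρ').differentiableAt_of_infty
  have dA'f : DifferentiableAt ℝ (fun x => dz (fun x => (u' x : ℂ)) (f x)) w :=
    DifferentiableAt.comp (g := dz fun x => (u' x : ℂ)) w dA' (hf.differentiableAt.restrictScalars ℝ)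
  have dR'f : DifferentiableAt ℝ (fun x => (ρ' (f x) : ℂ)) w :=
    DifferentiableAt.comp (g := fun y => (ρ' y : ℂ)) w dR' (hf.differentiableAt.restrictScalars ℝ)
  have eA : dz (fun x => (u x : ℂ)) =ᶠ[𝓝 w] fun x => dz (fun x => (u' x : ℂ)) (f x) * d x := by
    filter_upwards [hu.eventually_nhds, hf.eventually_analyticAt,
      hf.continuousAt.eventually (hs.mem_nhds hw)] with x hx hax hsx
    have e : (fun x => (u x : ℂ)) =ᶠ[𝓝 x] fun x => (u' (f x) : ℂ) := by
      filter_upwards [hx] with y hy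
      rw [hy]
    rw [dz_congr e]
    exact dz_comp_hasDerivAt (F := fun y => (u' y : ℂ)) hax.differentiableAt.hasDerivAt
      (contDiffAt_ofReal (hu' _ hsx)).differentiableAt_of_infty
  have eR : (fun x => (ρ x : ℂ)) =ᶠ[𝓝 w]
      fun x => (ρ' (f x) : ℂ) * (d x * (starRingEnd ℂ) (d x)) := by
    filter_upwards [hρ] with x hx
    rw [hx, Complex.mul_conj']
    push_cast
    rfl
  have eAA := dz_congr eA
  rw [dz_mul dA'f dd, dz_comp_hasDerivAt hfd dA', dz_of_hasDerivAt hdd] at eAA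
  have eRR := dz_congr eR
  rw [dz_mul dR'f (dd.fun_mul dds), dz_comp_hasDerivAt (F := fun y => (ρ' y : ℂ)) hfd dR',
    dz_mul dd dds, dz_star dd, dzbar_of_hasDerivAt hdd, dz_of_hasDerivAt hdd,
    dz_eq_dzLog_mul h0] at eRR
  have hds : (starRingEnd ℂ) (d w) ≠ 0 := by simpa using hf'
  have h0' : (ρ' (f w) : ℂ) ≠ 0 := mod_cast h0
  -- With d = f', one has A = (A'∘f)d and L = (L'∘f)d + d'/d, since |d|² = d d̄ and ∂_z d̄ = 0. The
  -- term A'd' from ∂_z A is then removed by the one from L A.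
  rw [eAA, eA.self_of_nhds, show dzLog ρ w = dz (fun x => (ρ x : ℂ)) w * ((ρ w : ℂ))⁻¹ from rfl,
    eRR, show (ρ w : ℂ) = _ from eR.self_of_nhds]
  simp only [map_zero, mul_zero, add_zero]
  field_simp
  ring

lemma eventually_mem_overlap {M : Type*} [TopologicalSpace M]
    {c c' : OpenPartialHomeomorph M ℂ} {w : ℂ} (hw : w ∈ c.target) (hw' : c.symm w ∈ c'.source) :
    ∀ᶠ x in 𝓝 w, x ∈ c.target ∧ c.symm x ∈ c'.source :=
  (c.open_target.eventually_mem hw).and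
    ((c.continuousAt_symm hw).eventually (c'.open_source.mem_nhds hw'))

/-! ### Transition maps and changes of spinor trivialization -/

section Charts

variable {M : Type*} [TopologicalSpace M] [ChartedSpace ℂ M]
  {c c' : OpenPartialHomeomorph M ℂ} {w : ℂ}

lemma analyticAt_transition (hc : c ∈ holCharts M) (hc' : c' ∈ holCharts M)
    (hw : w ∈ c.target) (hw' : c.symm w ∈ c'.source) : AnalyticAt ℂ (c' ∘ c.symm) w := by
  have h := StructureGroupoid.compatible_of_mem_maximalAtlas hc hc'
  rw [contDiffGroupoid, mem_groupoid_of_pregroupoid] at h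
  have h1 : ContDiffOn ℂ ω (c' ∘ c.symm) (c.symm.trans c').source := by
    simpa [contDiffPregroupoid] using h.1
  have hm : w ∈ (c.symm.trans c').source := by simp [hw, hw']
  exact ((h1 w hm).contDiffAt ((c.symm.trans c').open_source.mem_nhds hm)).analyticAt

lemma density_transition (g : ConformalMetric M) (hc : c ∈ holCharts M) (hc' : c' ∈ holCharts M)
    (hw : w ∈ c.target) (hw' : c.symm w ∈ c'.source) :
    g.density c w = g.density c' (c' (c.symm w)) * ‖deriv (c' ∘ c.symm) w‖ ^ 2 := by
  have := g.compat c hc c' hc' (c.symm w) ⟨c.map_target hw, hw'⟩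
  rwa [c.right_inv hw] at this

/-- Transition maps of a surface with a conformal metric have nonvanishing derivative. -/
lemma deriv_transition_ne_zero (g : ConformalMetric M) (hc : c ∈ holCharts M) (hc' : c' ∈ holCharts M)
    (hw : w ∈ c.target) (hw' : c.symm w ∈ c'.source) : deriv (c' ∘ c.symm) w ≠ 0 := by
  intro h0
  have h1 := density_transition g hc hc' hw hw'
  have h2 := g.pos c hc w hw
  rw [h1, h0] at h2
  simp at h2

lemma contDiffAt_density (g : ConformalMetric M) (hc : c ∈ holCharts M) (hw : w ∈ c.target) :
    ContDiffAt ℝ ∞ (g.density c) w :=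
  (g.smooth c hc).contDiffAt (c.open_target.mem_nhds hw)

lemma contDiffAt_loc {S : SpinStructure M} (ψ : SmoothSpinor S) (i : S.ι)
    (hw : w ∈ (S.chart i).target) : ContDiffAt ℝ ∞ (ψ.loc i) w :=
  (ψ.smooth i).contDiffAt ((S.chart i).open_target.mem_nhds hw)

variable (g : ConformalMetric M)

/-- The spinor part of the quadratic differential in the chart `c`, in terms of the isothermal
coordinate of the `i`-th trivialization. -/
lemma spinorTerm_eq {S : SpinStructure M} (ψ : SmoothSpinor S) (hc : c ∈ holCharts M) (i : S.ι)
    (hw : w ∈ c.target) (hw' : c.symm w ∈ (S.chart i).source) :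
    spinorTerm g ψ c i w =
      2 * ((Real.sqrt (g.density (S.chart i) (S.chart i (c.symm w))) : ℂ) *
        spinWronskian (ψ.loc i) (S.chart i (c.symm w))) *
        deriv (S.chart i ∘ c.symm) w ^ 2 := by
  have hq : S.chart i (c.symm w) ∈ (S.chart i).target := (S.chart i).map_source hw'
  have hf := (analyticAt_transition hc (S.chart_mem i) hw hw').differentiableAt.hasDerivAt
  have hX : fderiv ℝ (S.chart i ∘ c.symm) w (coordVec 0) = deriv (S.chart i ∘ c.symm) w := by
    rw [hf.complexToReal_fderiv.fderiv]; simp [coordVec]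
  have hY : fderiv ℝ (S.chart i ∘ c.symm) w (coordVec 1) =
      deriv (S.chart i ∘ c.symm) w * Complex.I := by
    rw [hf.complexToReal_fderiv.fderiv]; simp [coordVec]
  rw [← mul_assoc]
  exact spinorTerm_coord (g.pos _ (S.chart_mem i) _ hq)
    (contDiffAt_density g (S.chart_mem i) hq).differentiableAt_of_infty
    (contDiffAt_loc ψ i hq).differentiableAt_of_infty _ hX hY

lemma loc_transition {S : SpinStructure M} (ψ : SmoothSpinor S) (i j : S.ι) {x : ℂ}
    (hx : x ∈ (S.chart i).target) (hx' : (S.chart i).symm x ∈ (S.chart j).source) :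
    ψ.loc j (S.chart j ((S.chart i).symm x)) =
      ![(S.lift i j ((S.chart i).symm x) : ℂ) * ψ.loc i x 0,
        (starRingEnd ℂ) (S.lift i j ((S.chart i).symm x) : ℂ) * ψ.loc i x 1] := by
  have := ψ.compat i j _ ⟨(S.chart i).map_target hx, hx'⟩
  simp only [SmoothSpinor.loc, Function.comp_apply]
  rw [(S.chart j).left_inv hx', this]

/-- The cocycle is only assumed continuous. Its square is d/|d| with d the nonvanishing holomorphic
derivative of the transition map, and a continuous square root inherits differentiability. -/
lemma differentiableAt_lift (g : ConformalMetric M) (S : SpinStructure M) (i j : S.ι)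
    (hw : w ∈ (S.chart i).target) (hw' : (S.chart i).symm w ∈ (S.chart j).source) :
    DifferentiableAt ℝ (fun x => (S.lift i j ((S.chart i).symm x) : ℂ)) w := by
  have ha := analyticAt_transition (S.chart_mem i) (S.chart_mem j) hw hw'
  have hne := deriv_transition_ne_zero g (S.chart_mem i) (S.chart_mem j) hw hw'
  have dd : DifferentiableAt ℝ (deriv (S.chart j ∘ (S.chart i).symm)) w :=
    ha.deriv.differentiableAt.restrictScalars ℝ
  have hmem : (S.chart i).symm w ∈ (S.chart i).source ∩ (S.chart j).source :=
    ⟨(S.chart i).map_target hw, hw'⟩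
  have hc : ContinuousAt (fun x => (S.lift i j ((S.chart i).symm x) : ℂ)) w := by
    have h1 : ContinuousAt (S.lift i j) ((S.chart i).symm w) :=
      (S.lift_continuous i j).continuousAt
        (((S.chart i).open_source.inter (S.chart j).open_source).mem_nhds hmem)
    exact continuous_subtype_val.continuousAt.comp
      (h1.comp ((S.chart i).continuousAt_symm hw))
  refine differentiableAt_of_sq_eq (m := fun x => deriv (S.chart j ∘ (S.chart i).symm) x *
    ((‖deriv (S.chart j ∘ (S.chart i).symm) x‖⁻¹ : ℝ) : ℂ)) hc (Circle.coe_ne_zero _) ?_ ?_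
  · have hn : DifferentiableAt ℝ
        (fun x => ((‖deriv (S.chart j ∘ (S.chart i).symm) x‖⁻¹ : ℝ) : ℂ)) w :=
      Complex.ofRealCLM.differentiableAt.comp w ((dd.norm ℝ hne).inv (norm_ne_zero_iff.2 hne))
    exact dd.mul hn
  · filter_upwards [eventually_mem_overlap hw hw'] with x hx
    have := S.lift_sq i j _ ⟨(S.chart i).map_target hx.1, hx.2⟩
    rw [(S.chart i).right_inv hx.1] at this
    rw [this, div_eq_mul_inv, Complex.ofReal_inv]

/-- The spinor part of the quadratic differential in isothermal coordinates is compatible with a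
change of trivialization. -/
lemma sqrt_mul_spinWronskian_transition {S : SpinStructure M} (ψ : SmoothSpinor S) (i j : S.ι)
    (hw : w ∈ (S.chart i).target) (hw' : (S.chart i).symm w ∈ (S.chart j).source) :
    (Real.sqrt (g.density (S.chart i) w) : ℂ) * spinWronskian (ψ.loc i) w =
      (Real.sqrt (g.density (S.chart j) (S.chart j ((S.chart i).symm w))) : ℂ) *
        spinWronskian (ψ.loc j) (S.chart j ((S.chart i).symm w)) *
        deriv (S.chart j ∘ (S.chart i).symm) w ^ 2 := by
  have ha := analyticAt_transition (S.chart_mem i) (S.chart_mem j) hw hw'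
  have hne := deriv_transition_ne_zero g (S.chart_mem i) (S.chart_mem j) hw hw'
  set h : ℂ → ℂ := S.chart j ∘ (S.chart i).symm with hh
  set t : ℂ → ℂ := fun x => (starRingEnd ℂ) (S.lift i j ((S.chart i).symm x) : ℂ) with ht
  have dt : DifferentiableAt ℝ t w :=
    (Complex.conjCLE : ℂ →L[ℝ] ℂ).differentiableAt.comp w (differentiableAt_lift g S i j hw hw')
  have hq : h w ∈ (S.chart j).target := (S.chart j).map_source hw'
  have cj := contDiffAt_loc ψ j hq
  have ci := contDiffAt_loc ψ i hw
  have dj0 : DifferentiableAt ℝ (fun x => (starRingEnd ℂ) (ψ.loc j x 0)) (h w) :=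
    (contDiffAt_star (contDiffAt_pi.1 cj 0)).differentiableAt_of_infty
  have dj1 : DifferentiableAt ℝ (fun x => ψ.loc j x 1) (h w) :=
    (contDiffAt_pi.1 cj 1).differentiableAt_of_infty
  have di0 : DifferentiableAt ℝ (fun x => (starRingEnd ℂ) (ψ.loc i x 0)) w :=
    (contDiffAt_star (contDiffAt_pi.1 ci 0)).differentiableAt_of_infty
  have di1 : DifferentiableAt ℝ (fun x => ψ.loc i x 1) w :=
    (contDiffAt_pi.1 ci 1).differentiableAt_of_infty
  have e0 : (fun x => (starRingEnd ℂ) (ψ.loc j (h x) 0)) =ᶠ[𝓝 w]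
      fun x => t x * (starRingEnd ℂ) (ψ.loc i x 0) := by
    filter_upwards [eventually_mem_overlap hw hw'] with x hx
    simp [hh, loc_transition ψ i j hx.1 hx.2, ht]
  have e1 : (fun x => ψ.loc j (h x) 1) =ᶠ[𝓝 w] fun x => t x * ψ.loc i x 1 := by
    filter_upwards [eventually_mem_overlap hw hw'] with x hx
    simp [hh, loc_transition ψ i j hx.1 hx.2, ht]
  have f0 := dz_congr e0
  have f1 := dz_congr e1
  rw [dz_mul dt di0, dz_comp_hasDerivAt (F := fun x => (starRingEnd ℂ) (ψ.loc j x 0))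
    ha.differentiableAt.hasDerivAt dj0] at f0
  rw [dz_mul dt di1, dz_comp_hasDerivAt (F := fun x => ψ.loc j x 1)
    ha.differentiableAt.hasDerivAt dj1] at f1
  have v0 : (starRingEnd ℂ) (ψ.loc j (h w) 0) = t w * (starRingEnd ℂ) (ψ.loc i w 0) :=
    e0.self_of_nhds
  have v1 : ψ.loc j (h w) 1 = t w * ψ.loc i w 1 := e1.self_of_nhds
  have hsq := S.lift_sq i j _ ⟨(S.chart i).map_target hw, hw'⟩
  rw [(S.chart i).right_inv hw] at hsq
  have hnorm : (‖deriv h w‖ : ℂ) ≠ 0 := by simpa using hne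
  -- Since t is the conjugate of the lift, t² = d̄/|d|. This |d| is the factor by which √ρ changes.
  have hts : t w ^ 2 * deriv h w = ‖deriv h w‖ := by
    rw [ht, ← map_pow, hsq, map_div₀, Complex.conj_ofReal, div_mul_eq_mul_div,
      Complex.conj_mul', sq, mul_div_assoc, div_self hnorm, mul_one]
  -- Both φ₁ and φ̄₀ are multiplied by t, so the two terms with ∂_z t have the same product and
  -- cancel in the antisymmetric expression.
  have hV : spinWronskian (ψ.loc j) (h w) * deriv h w = t w ^ 2 * spinWronskian (ψ.loc i) w := by
    simp only [spinWronskian]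
    rw [v0, v1]
    linear_combination t w * (starRingEnd ℂ) (ψ.loc i w 0) * f1 - t w * ψ.loc i w 1 * f0
  have hρ : (Real.sqrt (g.density (S.chart i) w) : ℂ) =
      (Real.sqrt (g.density (S.chart j) (h w)) : ℂ) * ‖deriv h w‖ := by
    rw [density_transition g (S.chart_mem i) (S.chart_mem j) hw hw',
      Real.sqrt_mul' _ (sq_nonneg _), Real.sqrt_sq (norm_nonneg _), Complex.ofReal_mul]
    rfl
  change _ = (Real.sqrt (g.density (S.chart j) (h w)) : ℂ) *
    spinWronskian (ψ.loc j) (h w) * deriv h w ^ 2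
  rw [hρ, ← hts]
  linear_combination -(Real.sqrt (g.density (S.chart j) (h w)) : ℂ) * deriv h w * hV

lemma deriv_transition_comp {c'' : OpenPartialHomeomorph M ℂ} (hc : c ∈ holCharts M)
    (hc' : c' ∈ holCharts M) (hc'' : c'' ∈ holCharts M)
    (hw : w ∈ c.target) (hw' : c.symm w ∈ c'.source) (hw'' : c.symm w ∈ c''.source) :
    deriv (c'' ∘ c.symm) w =
      deriv (c'' ∘ c'.symm) (c' (c.symm w)) * deriv (c' ∘ c.symm) w := by
  have e : c'' ∘ c.symm =ᶠ[𝓝 w] (c'' ∘ c'.symm) ∘ (c' ∘ c.symm) := by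
    filter_upwards [eventually_mem_overlap hw hw'] with x hx
    simp [c'.left_inv hx.2]
  have h1 := (analyticAt_transition hc hc' hw hw').differentiableAt
  have h2 : DifferentiableAt ℂ (c'' ∘ c'.symm) ((c' ∘ c.symm) w) :=
    (analyticAt_transition hc' hc'' (c'.map_source hw')
      (by rwa [c'.left_inv hw'])).differentiableAt
  rw [e.deriv_eq, deriv_comp _ h2 h1]
  rfl

lemma spinorTerm_index {S : SpinStructure M} (ψ : SmoothSpinor S) (hc : c ∈ holCharts M)
    (i j : S.ι) (hw : w ∈ c.target) (hi : c.symm w ∈ (S.chart i).source)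
    (hj : c.symm w ∈ (S.chart j).source) :
    spinorTerm g ψ c i w = spinorTerm g ψ c j w := by
  have hl := (S.chart i).left_inv hi
  have h := sqrt_mul_spinWronskian_transition g ψ i j ((S.chart i).map_source hi) (by rwa [hl])
  rw [hl] at h
  rw [spinorTerm_eq g ψ hc i hw hi, spinorTerm_eq g ψ hc j hw hj, h,
    deriv_transition_comp hc (S.chart_mem i) (S.chart_mem j) hw hi hj]
  ring

/-- The two trivializations differ by unimodular factors on each component, so the Hermitian norm is
unchanged. -/
lemma normSq_eq {S : SpinStructure M} (ψ : SmoothSpinor S) (i : S.ι) {p : M}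
    (hp : p ∈ (S.chart i).source) : (ψ.normSq p : ℂ) = herm (ψ.comp i p) (ψ.comp i p) := by
  have hreal : ∀ a : Fin 2 → ℂ, ((herm a a).re : ℂ) = herm a a := by
    intro a
    simp [herm, Complex.mul_conj', ← Complex.ofReal_pow]
  rw [SmoothSpinor.normSq, hreal, ψ.compat i (S.indexAt p) p ⟨hp, S.mem_source p⟩]
  have hl : (S.lift i (S.indexAt p) p : ℂ) *
      (starRingEnd ℂ) (S.lift i (S.indexAt p) p : ℂ) = 1 := by
    rw [Complex.mul_conj', Circle.norm_coe]; simp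
  simp only [herm, Fin.sum_univ_two, Matrix.cons_val_zero, Matrix.cons_val_one, map_mul,
    Complex.conj_conj]
  linear_combination (ψ.comp i p 0 * (starRingEnd ℂ) (ψ.comp i p 0)
    + ψ.comp i p 1 * (starRingEnd ℂ) (ψ.comp i p 1)) * hl

end Charts

/-! ### Global properties of T -/

section Main

variable {M : Type*} [TopologicalSpace M] [ChartedSpace ℂ M]
  {c c' : OpenPartialHomeomorph M ℂ} {w : ℂ}
  {g : ConformalMetric M} {S : SpinStructure M} {u : M → ℝ} {ψ : SmoothSpinor S}

lemma localT_index (hc : c ∈ holCharts M) (i j : S.ι) (hw : w ∈ c.target)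
    (hi : c.symm w ∈ (S.chart i).source) (hj : c.symm w ∈ (S.chart j).source) :
    localT g u ψ c i w = localT g u ψ c j w := by
  rw [localT, localT, spinorTerm_index g ψ hc i j hw hi hj]

lemma localT_eq_coeffT (hc : c ∈ holCharts M) (i : S.ι) (hw : w ∈ c.target)
    (hi : c.symm w ∈ (S.chart i).source) : localT g u ψ c i w = coeffT g u ψ c w :=
  localT_index hc i _ hw hi (S.mem_source _)

lemma IsSmoothSolution.contDiffAt (h : IsSmoothSolution g S u ψ) (hc : c ∈ holCharts M)
    (hw : w ∈ c.target) : ContDiffAt ℝ ∞ (u ∘ c.symm) w :=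
  (h.smooth c hc).contDiffAt (c.open_target.mem_nhds hw)

lemma dzFun_sub_dzzFun (h : IsSmoothSolution g S u ψ) (hc : c ∈ holCharts M)
    (hw : w ∈ c.target) :
    dzFun u c w ^ 2 - dzzFun g u c w = dz (fun x => ((u ∘ c.symm) x : ℂ)) w ^ 2
      - (dz (dz (fun x => ((u ∘ c.symm) x : ℂ))) w
        - dzLog (g.density c) w * dz (fun x => ((u ∘ c.symm) x : ℂ)) w) := by
  have hu : ∀ x ∈ c.target, ContDiffAt ℝ ∞ (u ∘ c.symm) x := fun x hx => h.contDiffAt hc hx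
  rw [← hessian_eq_dz_dz c.open_target hu hw
      (contDiffAt_density g hc hw).differentiableAt_of_infty,
    dz_ofReal (hu w hw).differentiableAt_of_infty]
  rfl

/-- The coefficient `T` in terms of the Wirtinger derivatives. -/
lemma coeffT_eq (h : IsSmoothSolution g S u ψ) (hc : c ∈ holCharts M) (i : S.ι)
    (hw : w ∈ c.target) (hi : c.symm w ∈ (S.chart i).source) :
    coeffT g u ψ c w = dz (fun x => ((u ∘ c.symm) x : ℂ)) w ^ 2
      - (dz (dz (fun x => ((u ∘ c.symm) x : ℂ))) w
        - dzLog (g.density c) w * dz (fun x => ((u ∘ c.symm) x : ℂ)) w)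
      + (1 / 2) * ((Real.sqrt (g.density (S.chart i) (S.chart i (c.symm w))) : ℂ) *
        spinWronskian (ψ.loc i) (S.chart i (c.symm w)) *
        deriv (S.chart i ∘ c.symm) w ^ 2) := by
  rw [← localT_eq_coeffT hc i hw hi, localT, dzFun_sub_dzzFun h hc hw,
    spinorTerm_eq g ψ hc i hw hi]
  ring

/-- The trivialization in `coeffT` is chosen point by point, without continuity. Independence of the
choice permits a fixed index near the point, as differentiation requires. -/
lemma coeffT_eventuallyEq (h : IsSmoothSolution g S u ψ) (hc : c ∈ holCharts M) (i : S.ι)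
    (hw : w ∈ c.target) (hi : c.symm w ∈ (S.chart i).source) :
    coeffT g u ψ c =ᶠ[𝓝 w] fun w => dz (fun x => ((u ∘ c.symm) x : ℂ)) w ^ 2
      - (dz (dz (fun x => ((u ∘ c.symm) x : ℂ))) w
        - dzLog (g.density c) w * dz (fun x => ((u ∘ c.symm) x : ℂ)) w)
      + (1 / 2) * ((Real.sqrt (g.density (S.chart i) (S.chart i (c.symm w))) : ℂ) *
        spinWronskian (ψ.loc i) (S.chart i (c.symm w)) *
        deriv (S.chart i ∘ c.symm) w ^ 2) := by
  filter_upwards [eventually_mem_overlap hw hi] with x hx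
  exact coeffT_eq h hc i hx.1 hx.2

variable (g ψ) in
lemma contDiffAt_sqrt_mul_spinWronskian (i : S.ι) (hw : w ∈ (S.chart i).target) :
    ContDiffAt ℝ ∞ (fun x => (Real.sqrt (g.density (S.chart i) x) : ℂ) *
      spinWronskian (ψ.loc i) x) w := by
  have c0 := contDiffAt_pi.1 (contDiffAt_loc ψ i hw) 0
  have c1 := contDiffAt_pi.1 (contDiffAt_loc ψ i hw) 1
  exact (contDiffAt_ofReal ((contDiffAt_density g (S.chart_mem i) hw).sqrt
    (g.pos _ (S.chart_mem i) _ hw).ne')).mul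
    (((contDiffAt_dz c1).mul (contDiffAt_star c0)).sub
      (c1.mul (contDiffAt_dz (contDiffAt_star c0))))

variable (g ψ) in
lemma contDiffAt_spinor_part (hc : c ∈ holCharts M) (i : S.ι)
    (hw : w ∈ c.target) (hi : c.symm w ∈ (S.chart i).source) :
    ContDiffAt ℝ ∞ (fun w => (1 / 2) *
      ((Real.sqrt (g.density (S.chart i) (S.chart i (c.symm w))) : ℂ) *
        spinWronskian (ψ.loc i) (S.chart i (c.symm w)) *
        deriv (S.chart i ∘ c.symm) w ^ 2)) w := by
  have ha := analyticAt_transition hc (S.chart_mem i) hw hi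
  have hW := contDiffAt_sqrt_mul_spinWronskian g ψ i ((S.chart i).map_source hi)
  have hd : ContDiffAt ℝ ∞ (deriv (S.chart i ∘ c.symm)) w :=
    (ha.deriv.contDiffAt (n := ∞)).restrict_scalars ℝ
  have hf : ContDiffAt ℝ ∞ (S.chart i ∘ c.symm) w :=
    (ha.contDiffAt (n := ∞)).restrict_scalars ℝ
  have hWf : ContDiffAt ℝ ∞ (fun w =>
      (Real.sqrt (g.density (S.chart i) (S.chart i (c.symm w))) : ℂ) *
        spinWronskian (ψ.loc i) (S.chart i (c.symm w))) w :=
    ContDiffAt.comp (g := fun x => (Real.sqrt (g.density (S.chart i) x) : ℂ) *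
      spinWronskian (ψ.loc i) x) w hW hf
  exact contDiffAt_const.mul (hWf.mul (hd.pow 2))

lemma contDiffAt_coeffT (h : IsSmoothSolution g S u ψ) (hc : c ∈ holCharts M)
    (hw : w ∈ c.target) : ContDiffAt ℝ ∞ (coeffT g u ψ c) w := by
  have hi := S.mem_source (c.symm w)
  have cA := contDiffAt_dz (contDiffAt_ofReal (h.contDiffAt hc hw))
  exact (((cA.pow 2).sub ((contDiffAt_dz cA).sub
    ((contDiffAt_dzLog (contDiffAt_density g hc hw) (g.pos c hc w hw).ne').mul cA))).add
    (contDiffAt_spinor_part g ψ hc _ hw hi)).congr_of_eventuallyEq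
    (coeffT_eventuallyEq h hc _ hw hi)

lemma coeffT_transition (h : IsSmoothSolution g S u ψ) (hc : c ∈ holCharts M)
    (hc' : c' ∈ holCharts M) {p : M} (hp : p ∈ c.source ∩ c'.source) :
    coeffT g u ψ c (c p) = coeffT g u ψ c' (c' p) * deriv (c' ∘ c.symm) (c p) ^ 2 := by
  have hw := c.map_source hp.1
  have hl := c.left_inv hp.1
  have hw' : c.symm (c p) ∈ c'.source := by rw [hl]; exact hp.2
  have hv := c'.map_source hp.2
  have hl' := c'.left_inv hp.2
  -- One trivialization at p serves both charts, so the spinor parts differ only by the chain-rule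
  -- factor.
  have hi : c.symm (c p) ∈ (S.chart (S.indexAt p)).source := by rw [hl]; exact S.mem_source p
  have hi' : c'.symm (c' p) ∈ (S.chart (S.indexAt p)).source := by rw [hl']; exact S.mem_source p
  have hq := quadratic_comp (ρ := g.density c) (ρ' := g.density c') (u := u ∘ c.symm)
    (u' := u ∘ c'.symm) (analyticAt_transition hc hc' hw hw')
    (deriv_transition_ne_zero g hc hc' hw hw') c'.open_target
    (by simpa [hl] using hv) (fun x hx => h.contDiffAt hc' hx)
    (contDiffAt_density g hc' (by simpa [hl] using hv))
    (g.pos c' hc' _ (by simpa [hl] using hv)).ne'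
    (by
      filter_upwards [eventually_mem_overlap hw hw'] with x hx
      simp [c'.left_inv hx.2])
    (by
      filter_upwards [eventually_mem_overlap hw hw'] with x hx
      exact density_transition g hc hc' hx.1 hx.2)
  have hch := deriv_transition_comp hc hc' (S.chart_mem (S.indexAt p)) hw hw' hi
  rw [coeffT_eq h hc _ hw hi, coeffT_eq h hc' _ hv hi', hq, hch]
  simp only [Function.comp_apply, hl, hl']
  ring

/-- The Liouville equation is used in the chart c, but the Dirac equation is only given in the
charts of the spin structure. The holomorphic transition f carries the spinor computation over to c.
-/
lemma dzbar_coeffT (h : IsSmoothSolution g S u ψ) (hc : c ∈ holCharts M) (hw : w ∈ c.target) :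
    dzbar (coeffT g u ψ c) w =
      -((g.density c w : ℂ) / 4) * dz (fun x => (g.gauss c x : ℂ)) w := by
  set i := S.indexAt (c.symm w)
  have hi : c.symm w ∈ (S.chart i).source := S.mem_source _
  have hci := S.chart_mem i
  set f : ℂ → ℂ := S.chart i ∘ c.symm with hf
  have ha : AnalyticAt ℂ f w := analyticAt_transition hc hci hw hi
  have hfd : HasDerivAt f (deriv f w) w := ha.differentiableAt.hasDerivAt
  have hdd : HasDerivAt (fun x => deriv f x ^ 2) _ w :=
    (ha.deriv.pow 2).differentiableAt.hasDerivAt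
  have hq : f w ∈ (S.chart i).target := (S.chart i).map_source hi
  set n : ℂ → ℝ := fun x => ψ.normSq (c.symm x) with hn
  set N : ℂ → ℂ := fun x => herm (ψ.loc i x) (ψ.loc i x) with hN
  have cN : ∀ x ∈ (S.chart i).target, ContDiffAt ℝ ∞ N x := by
    intro x hx
    have c0 := contDiffAt_pi.1 (contDiffAt_loc ψ i hx) 0
    have c1 := contDiffAt_pi.1 (contDiffAt_loc ψ i hx) 1
    have : N = fun x => ψ.loc i x 0 * (starRingEnd ℂ) (ψ.loc i x 0)
        + ψ.loc i x 1 * (starRingEnd ℂ) (ψ.loc i x 1) := by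
      funext y; simp [hN, herm, Fin.sum_univ_two]
    rw [this]
    exact (c0.mul (contDiffAt_star c0)).add (c1.mul (contDiffAt_star c1))
  have cf : ContDiffAt ℝ ∞ f w := (ha.contDiffAt (n := ∞)).restrict_scalars ℝ
  have en : (fun x => (n x : ℂ)) =ᶠ[𝓝 w] fun x => N (f x) := by
    filter_upwards [eventually_mem_overlap hw hi] with x hx
    simp [hn, hN, normSq_eq ψ i hx.2, SmoothSpinor.loc, hf, (S.chart i).left_inv hx.2]
  have eu : (fun x => ((u ∘ c.symm) x : ℂ)) =ᶠ[𝓝 w]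
      fun x => ((u ∘ (S.chart i).symm) (f x) : ℂ) := by
    filter_upwards [eventually_mem_overlap hw hi] with x hx
    simp [hf, (S.chart i).left_inv hx.2]
  have cn : ContDiffAt ℝ ∞ n w := by
    have h1 : ContDiffAt ℝ ∞ (fun x => (N (f x)).re) w :=
      Complex.reCLM.contDiff.contDiffAt.comp w (ContDiffAt.comp w (cN _ hq) cf)
    refine h1.congr_of_eventuallyEq ?_
    filter_upwards [en] with x hx
    rw [← hx, Complex.ofReal_re]
  have hD : ∀ x ∈ (S.chart i).target, dirac (g.density (S.chart i)) (ψ.loc i) x =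
      -((Real.exp ((u ∘ (S.chart i).symm) x) : ℝ) : ℂ) • ψ.loc i x := by
    intro x hx
    have := h.dirac i _ ((S.chart i).map_target hx)
    rwa [(S.chart i).right_inv hx] at this
  have hW := dzbar_sqrt_mul_spinWronskian (S.chart i).open_target hq
    (fun x hx => contDiffAt_density g hci hx) (fun x hx => g.pos _ hci x hx)
    (fun x hx => h.contDiffAt hci hx) (fun x hx => contDiffAt_loc ψ i hx) hD
  have cW := contDiffAt_sqrt_mul_spinWronskian g ψ i hq
  have dW := cW.differentiableAt_of_infty
  have dWf : DifferentiableAt ℝ (fun x => (Real.sqrt (g.density (S.chart i) (f x)) : ℂ) *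
      spinWronskian (ψ.loc i) (f x)) w :=
    (ContDiffAt.comp w cW cf).differentiableAt_of_infty
  have hρ : (g.density c w : ℂ) =
      g.density (S.chart i) (f w) * (deriv f w * (starRingEnd ℂ) (deriv f w)) := by
    rw [density_transition g hc hci hw hi, Complex.mul_conj']
    push_cast
    rfl
  have dQ := (contDiffAt_spinor_part g ψ hc i hw hi).differentiableAt_of_infty
  have dd2 : DifferentiableAt ℝ (fun x => deriv f x ^ 2) w :=
    hdd.differentiableAt.restrictScalars ℝ
  rw [dzbar_congr (coeffT_eventuallyEq h hc i hw hi)]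
  refine dzbar_quadratic (n := n) c.open_target hw (fun x hx => contDiffAt_density g hc hx)
    (fun x hx => g.pos c hc x hx) (fun x hx => h.contDiffAt hc hx) cn dQ ?_ ?_
  · change dzbar (fun w => (1 / 2) * ((Real.sqrt (g.density (S.chart i) (f w)) : ℂ) *
      spinWronskian (ψ.loc i) (f w) * deriv f w ^ 2)) w = _
    -- The chain rule for ∂_z̄ gives one factor of the conjugate of f', and f'² is annihilated by
    -- ∂_z̄. One f' combines with the conjugate to turn the density of the trivializing chart into
    -- that of c, and the other turns its ∂_z-derivatives into those in c.
    rw [dzbar_const_mul (f := fun w => (Real.sqrt (g.density (S.chart i) (f w)) : ℂ) *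
        spinWronskian (ψ.loc i) (f w) * deriv f w ^ 2) _ (dWf.fun_mul dd2), dzbar_mul dWf dd2,
      dzbar_comp_hasDerivAt (F := fun x => (Real.sqrt (g.density (S.chart i) x) : ℂ) *
        spinWronskian (ψ.loc i) x) hfd dW, hW, dzbar_of_hasDerivAt hdd, dz_congr en,
      dz_congr eu, dz_comp_hasDerivAt hfd (cN _ hq).differentiableAt_of_infty,
      dz_comp_hasDerivAt (F := fun x => ((u ∘ (S.chart i).symm) x : ℂ)) hfd
        (contDiffAt_ofReal (h.contDiffAt hci hq)).differentiableAt_of_infty,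
      show (n w : ℂ) = N (f w) from en.self_of_nhds, hρ,
      show (u ∘ c.symm) w = (u ∘ (S.chart i).symm) (f w) by
        simp [hf, (S.chart i).left_inv hi]]
    simp only [hN]
    ring
  · intro x hx
    have := h.liouville c hc _ (c.map_target hx)
    rwa [c.right_inv hx] at this

/-- The Cauchy-Riemann equation in terms of `∂_z̄`. -/
lemma differentiableAt_of_dzbar_eq_zero {f : ℂ → ℂ} (hf : DifferentiableAt ℝ f w)
    (h : dzbar f w = 0) : DifferentiableAt ℂ f w := by
  rw [differentiableAt_complex_iff_differentiableAt_real]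
  refine ⟨hf, ?_⟩
  rw [fderiv_eq_dz_dzbar, fderiv_eq_dz_dzbar, h]
  simp [mul_comm]

end Main

end SuperLiouville

theorem proposition3p3 {M : Type*} [TopologicalSpace M] [ChartedSpace ℂ M]
    [IsManifold 𝓘(ℂ) ω M]
    (g : SuperLiouville.ConformalMetric M) (S : SuperLiouville.SpinStructure M)
    (u : M → ℝ) (ψ : SuperLiouville.SmoothSpinor S)
    (h : SuperLiouville.IsSmoothSolution g S u ψ) :
    -- `T` does not depend on the trivialization of the spinor bundle, and it is smooth
    (∀ c ∈ SuperLiouville.holCharts M, ∀ i, ∀ w ∈ c.target, c.symm w ∈ (S.chart i).source →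
      SuperLiouville.localT g u ψ c i w = SuperLiouville.coeffT g u ψ c w) ∧
    (∀ c ∈ SuperLiouville.holCharts M,
      ContDiffOn ℝ ∞ (SuperLiouville.coeffT g u ψ c) c.target) ∧
    -- `T(z) dz²` is a quadratic differential
    (∀ c ∈ SuperLiouville.holCharts M, ∀ c' ∈ SuperLiouville.holCharts M,
      ∀ p ∈ c.source ∩ c'.source,
      SuperLiouville.coeffT g u ψ c (c p) =
        SuperLiouville.coeffT g u ψ c' (c' p) * deriv (c' ∘ c.symm) (c p) ^ 2) ∧
    -- the general formula `∂_{z̄} T = -(ρ / 4) ∂_z K_g`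
    (∀ c ∈ SuperLiouville.holCharts M, ∀ w ∈ c.target,
      SuperLiouville.dzbar (SuperLiouville.coeffT g u ψ c) w =
        -((g.density c w : ℂ) / 4) * SuperLiouville.dz (fun x => (g.gauss c x : ℂ)) w) ∧
    -- if the curvature is constant, `T(z) dz²` is holomorphic
    ((∃ k : ℝ, ∀ c ∈ SuperLiouville.holCharts M, ∀ w ∈ c.target, g.gauss c w = k) →
      ∀ c ∈ SuperLiouville.holCharts M,
        DifferentiableOn ℂ (SuperLiouville.coeffT g u ψ c) c.target) := by
  
  refine ⟨fun c hc i w hw hi => SuperLiouville.localT_eq_coeffT hc i hw hi,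
    fun c hc w hw => (SuperLiouville.contDiffAt_coeffT h hc hw).contDiffWithinAt,
    fun c hc c' hc' p hp => SuperLiouville.coeffT_transition h hc hc' hp,
    fun c hc w hw => SuperLiouville.dzbar_coeffT h hc hw, ?_⟩
  rintro ⟨k, hk⟩ c hc w hw
  -- Constant curvature makes ∂_z K vanish, hence ∂_z̄ T = 0. As T is real differentiable, the
  -- Cauchy-Riemann equation gives holomorphy.
  have e : (fun x => (g.gauss c x : ℂ)) =ᶠ[nhds w] fun _ => (k : ℂ) := by
    filter_upwards [c.open_target.mem_nhds hw] with x hx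
    rw [hk c hc x hx]
  refine (SuperLiouville.differentiableAt_of_dzbar_eq_zero
    (SuperLiouville.contDiffAt_coeffT h hc hw).differentiableAt_of_infty
    ?_).differentiableWithinAt
  rw [SuperLiouville.dzbar_coeffT h hc hw, SuperLiouville.dz_congr e,
    SuperLiouville.dz_of_hasDerivAt (hasDerivAt_const w (k : ℂ)), mul_zero]
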